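/- Let $d,k,n$ be integers with $1\le k\le d-2$ and $n\ge 2$. Let $\mathbf P\subset\mathbb E^d$ be a $d$-dimensional convex polytope, and let $\mathcal P=\{\mathbf x_i+\tau_i\mathbf P : i=1,\dots,n\}$ with $\mathbf x_i\in\mathbb E^d$ and $\tau_i>0$. Call $\mathcal P$ a *$k$-WIP-family* if every $k$-dimensional affine subspace of $\mathbb E^d$ that is parallel to a facet of $\mathbf P$ (i.e., has a translate lying in the hyperplane of a facet of $\mathbf P$) and intersects $\operatorname{conv}(\bigcup\mathcal P)$ also intersects at least one member of $\mathcal P$. Let $\Lambda_k(\mathcal P)$ denote the smallest $\lambda>0$ such that some translate of $\lambda\left(\sum_{i=1}^n\tau_i\right)\mathbf P$ covers $\bigcup\mathcal P$. (a) If $\mathcal P$ is a $k$-WIP-family, then $\operatorname{conv}(\bigcup\mathcal P)$ slides freely inside $\mathbf K:=\left(\sum_{i=1}^n\tau_i\right)\mathbf P$, that is, for every boundary point $\mathbf p$ of $\mathbf K$ there is a vector $\mathbf y\in\mathbb E^d$ with $\mathbf p\in\mathbf y+\operatorname{conv}(\bigcup\mathcal P)\subseteq\mathbf K$; equivalently,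 $\operatorname{conv}(\bigcup\mathcal P)$ is a Minkowski summand of $\mathbf K$, that is, $\operatorname{conv}(\bigcup\mathcal P)+\mathbf K'=\mathbf K$ for some nonempty compact convex set $\mathbf K'$. Moreover, the minimum defining $\Lambda_k(\mathcal P)$ exists, and $\Lambda_k(\mathcal P)\le 1$. (b) If $\mathbf P$ is a $d$-dimensional cube and $\mathcal P$ consists of $n$ translates of $\mathbf P$ (all $\tau_i=1$) that have pairwise disjoint interiors, whose union is a ($d$-dimensional) rectangular box, and whose centers lie on a line, then $\mathcal P$ is a $k$-WIP-family and $\Lambda_k(\mathcal P)=1$. -/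

import Mathlib

open scoped Pointwise

namespace WIP

/-- Euclidean `d`-space. -/
abbrev E (d : ℕ) : Type := EuclideanSpace ℝ (Fin d)

/-- A `d`-dimensional convex polytope in `E d`: the convex hull of finitely many points, with
nonempty interior. -/
def IsFullPolytope {d : ℕ} (P : Set (E d)) : Prop :=
  (∃ V : Finset (E d), P = convexHull ℝ (V : Set (E d))) ∧ (interior P).Nonempty

/-- A facet of a `d`-dimensional polytope: a (nonempty exposed) face of dimension `d - 1`. -/
def IsFacet {d : ℕ} (P F : Set (E d)) : Prop :=
  F.Nonempty ∧ IsExposed ℝ P F ∧ Module.finrank ℝ (vectorSpan ℝ F) + 1 = d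

/-- The flat `L` is parallel to a facet of `P`: some translate of `L` lies in the hyperplane
spanned by a facet of `P`. -/
def ParallelToFacet {d : ℕ} (L : AffineSubspace ℝ (E d)) (P : Set (E d)) : Prop :=
  ∃ F : Set (E d), IsFacet P F ∧
    ∃ v : E d, v +ᵥ (L : Set (E d)) ⊆ (affineSpan ℝ F : Set (E d))

/-- The `i`-th member `x i + τ i P` of a family of homothets of `P`. -/
def homothet {d n : ℕ} (P : Set (E d)) (x : Fin n → E d) (τ : Fin n → ℝ) (i : Fin n) :
    Set (E d) :=
  x i +ᵥ τ i • P

/-- The union of the family. -/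
def familyUnion {d n : ℕ} (P : Set (E d)) (x : Fin n → E d) (τ : Fin n → ℝ) : Set (E d) :=
  ⋃ i, homothet P x τ i

/-- Weakly `k`-impassable family: every `k`-flat that is parallel to a facet of `P` and meets the
convex hull of the union meets a member. -/
def IsWIP {d n : ℕ} (k : ℕ) (P : Set (E d)) (x : Fin n → E d) (τ : Fin n → ℝ) : Prop :=
  ∀ L : AffineSubspace ℝ (E d), Module.finrank ℝ L.direction = k → ParallelToFacet L P →
    ((L : Set (E d)) ∩ convexHull ℝ (familyUnion P x τ)).Nonempty →
    ∃ i, ((L : Set (E d)) ∩ homothet P x τ i).Nonempty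

/-- The positive `l` such that a translate of `l (∑ τ i) P` covers the union of the family. -/
def coverFactors {d n : ℕ} (P : Set (E d)) (x : Fin n → E d) (τ : Fin n → ℝ) : Set ℝ :=
  {l | 0 < l ∧ ∃ t : E d, familyUnion P x τ ⊆ t +ᵥ (l * ∑ i, τ i) • P}

/-- The smallest positive `l` such that a translate of `l (∑ τ i) P` covers the union of the
family (an infimum here; that it is attained is asserted where it is used). -/
noncomputable def Lam {d n : ℕ} (P : Set (E d)) (x : Fin n → E d) (τ : Fin n → ℝ) : ℝ :=
  sInf (coverFactors P x τ)

/-- `K₂` slides freely inside `K₁`. -/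
def SlidesFreely {d : ℕ} (K₂ K₁ : Set (E d)) : Prop :=
  ∀ p ∈ frontier K₁, ∃ y : E d, p ∈ y +ᵥ K₂ ∧ y +ᵥ K₂ ⊆ K₁

/-- `K₂` is a (Minkowski) summand of `K₁`. -/
def IsSummand {d : ℕ} (K₂ K₁ : Set (E d)) : Prop :=
  ∃ K : Set (E d), K.Nonempty ∧ IsCompact K ∧ Convex ℝ K ∧ K₂ + K = K₁

/-- The rectangular box with center `c`, edges in the directions of the orthonormal basis `b`,
and edge lengths `w j`. -/
def box {d : ℕ} (b : OrthonormalBasis (Fin d) ℝ (E d)) (c : E d) (w : Fin d → ℝ) : Set (E d) :=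
  {p | ∀ j, |inner ℝ (b j) (p - c)| ≤ w j / 2}

/-- `B` is a (nondegenerate) rectangular box, in any position. -/
def IsBox {d : ℕ} (B : Set (E d)) : Prop :=
  ∃ (b : OrthonormalBasis (Fin d) ℝ (E d)) (c : E d) (w : Fin d → ℝ),
    (∀ j, 0 < w j) ∧ B = box b c w

/-- `C` is a `d`-cube with center `c`, in any position. -/
def IsCube {d : ℕ} (C : Set (E d)) (c : E d) : Prop :=
  ∃ (b : OrthonormalBasis (Fin d) ℝ (E d)) (s : ℝ), 0 < s ∧ C = box b c (fun _ => s)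

end WIP

/-! Let `P = conv V`, let `W` be the set of all vertices of the members, `T = ∑ τ i`, and let `h_V`,
`h_W` be the support functions. If `f = T h_V - h_W` is subadditive, Hahn–Banach makes it the
support function of a convex body `K` with `conv W + K = T P`. Free sliding and `Λ ≤ 1` follow at
once (`exists_add_eq_of_suppFun_sub_add_le`).

Subadditivity is local. By continuity only segments in general position matter; on these every
functional is maximal on a vertex or an edge of `P` (`dense_collinear_argmax`). A maximum principle
on the segment then reduces the claim to first-order expansions: the `u`-face of `conv W` must be at
most `T` times as wide as the `u`-face of `P`. When the latter is a vertex or an edge, it suffices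
to compare widths along facet normals, since the normals of facets containing an edge span its
orthogonal complement (`exists_inner_le_of_forall_facetNormal`).

Impassability gives this comparison (`IsWIP.abs_inner_sub_le`). As `k ≤ d - 2`, some `k`-flat
through any point of the `u`-face of `conv W` is orthogonal to both `u` and a facet normal `u'`. It
meets a member, necessarily in that member's `u`-face. So the `u'`-projections of the members' faces
cover that of the big face, and lengths add up.

For a row of cubes, a convex union forces the line of centers to be parallel to an edge. Along this
axis `n` disjoint intervals of length `s` must fit into one of length `l n s`, so `l ≥ 1`. -/

namespace WIP

/-! ### Support functions of finite sets and their first-order behaviour. -/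

section SupportFunction

variable {F : Type*} [NormedAddCommGroup F] [InnerProductSpace ℝ F]

/-- The support function of the convex hull of a nonempty finite set. -/
noncomputable def suppFun (V : Finset F) (hV : V.Nonempty) (u : F) : ℝ :=
  V.sup' hV fun v => inner ℝ v u

open Classical in
/-- The points of a finite set at which a linear functional is maximal. -/
noncomputable def argmax (V : Finset F) (u : F) : Finset F :=
  V.filter fun v => ∀ w ∈ V, (inner ℝ w u : ℝ) ≤ inner ℝ v u

variable {V : Finset F} {u : F}

theorem mem_argmax {v : F} :
    v ∈ argmax V u ↔ v ∈ V ∧ ∀ w ∈ V, (inner ℝ w u : ℝ) ≤ inner ℝ v u := by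
  classical
  simp [argmax]

theorem argmax_nonempty (hV : V.Nonempty) (u : F) : (argmax V u).Nonempty := by
  obtain ⟨v, hv, h⟩ := V.exists_max_image (fun v => (inner ℝ v u : ℝ)) hV
  exact ⟨v, mem_argmax.2 ⟨hv, h⟩⟩

theorem inner_le_suppFun (hV : V.Nonempty) {v : F} (hv : v ∈ V) (u : F) :
    (inner ℝ v u : ℝ) ≤ suppFun V hV u :=
  Finset.le_sup' (fun v => (inner ℝ v u : ℝ)) hv

theorem inner_eq_suppFun_of_mem_argmax (hV : V.Nonempty) {v : F} (hv : v ∈ argmax V u) :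
    (inner ℝ v u : ℝ) = suppFun V hV u :=
  le_antisymm (inner_le_suppFun hV (mem_argmax.1 hv).1 u)
    (Finset.sup'_le _ _ (mem_argmax.1 hv).2)

theorem mem_argmax_iff (hV : V.Nonempty) {v : F} :
    v ∈ argmax V u ↔ v ∈ V ∧ (inner ℝ v u : ℝ) = suppFun V hV u := by
  refine ⟨fun h => ⟨(mem_argmax.1 h).1, inner_eq_suppFun_of_mem_argmax hV h⟩, fun h => ?_⟩
  exact mem_argmax.2 ⟨h.1, fun w hw => h.2 ▸ inner_le_suppFun hV hw u⟩

theorem convex_inner_le (u : F) (c : ℝ) : Convex ℝ {p : F | (inner ℝ p u : ℝ) ≤ c} := by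
  intro p hp q hq a b ha hb hab
  simp only [Set.mem_ofPred_eq, inner_add_left, real_inner_smul_left] at *
  calc a * inner ℝ p u + b * inner ℝ q u ≤ a * c + b * c := by gcongr
    _ = c := by rw [← add_mul, hab, one_mul]

theorem inner_le_suppFun_of_mem_convexHull (hV : V.Nonempty) {p : F}
    (hp : p ∈ convexHull ℝ (V : Set F)) (u : F) : (inner ℝ p u : ℝ) ≤ suppFun V hV u :=
  convexHull_min (fun _ hv => inner_le_suppFun hV hv u) (convex_inner_le u _) hp

theorem continuous_suppFun (hV : V.Nonempty) : Continuous (suppFun V hV) := by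
  unfold suppFun
  exact Continuous.finset_sup'_apply hV fun v _ => by fun_prop

theorem suppFun_smul (hV : V.Nonempty) {r : ℝ} (hr : 0 ≤ r) (u : F) :
    suppFun V hV (r • u) = r * suppFun V hV u := by
  obtain ⟨v, hv⟩ := argmax_nonempty hV u
  rw [← inner_eq_suppFun_of_mem_argmax hV hv]
  apply le_antisymm
  · refine Finset.sup'_le _ _ fun w hw => ?_
    rw [inner_smul_right]
    exact mul_le_mul_of_nonneg_left ((mem_argmax.1 hv).2 w hw) hr
  · rw [← inner_smul_right]
    exact inner_le_suppFun hV (mem_argmax.1 hv).1 _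

/-- One-sided first-order expansion of the support function of a finite set. -/
theorem exists_argmax_eventually_suppFun_le (hV : V.Nonempty) (u z : F) :
    ∃ p ∈ argmax V u, (∀ m ∈ argmax V u, (inner ℝ m z : ℝ) ≤ inner ℝ p z) ∧
      ∀ᶠ ε : ℝ in nhdsWithin 0 (Set.Ioi 0),
        suppFun V hV (u + ε • z) ≤ suppFun V hV u + ε * inner ℝ p z := by
  obtain ⟨p, hp, hmax⟩ := (argmax V u).exists_max_image (fun v => (inner ℝ v z : ℝ))
    (argmax_nonempty hV u)
  refine ⟨p, hp, hmax, ?_⟩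
  -- Among maximizers of `u` only the slope in direction `z` counts; all other points are strictly
  -- below at `ε = 0` and stay below for small `ε`.
  have key : ∀ w ∈ V, ∀ᶠ ε : ℝ in nhdsWithin 0 (Set.Ioi 0),
      (inner ℝ w (u + ε • z) : ℝ) ≤ suppFun V hV u + ε * inner ℝ p z := by
    intro w hw
    by_cases hwm : w ∈ argmax V u
    · filter_upwards [self_mem_nhdsWithin] with ε (hε : 0 < ε)
      rw [inner_add_right, inner_smul_right, inner_eq_suppFun_of_mem_argmax hV hwm]
      have := hmax w hwm
      gcongr
    · have hlt : (inner ℝ w u : ℝ) < suppFun V hV u :=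
        lt_of_le_of_ne (inner_le_suppFun hV hw u)
          fun h => hwm ((mem_argmax_iff hV).2 ⟨hw, h⟩)
      have hc : ContinuousAt (fun ε : ℝ => suppFun V hV u + ε * inner ℝ p z
          - inner ℝ w (u + ε • z)) 0 := by fun_prop
      have h0 : (0 : ℝ) < suppFun V hV u + 0 * inner ℝ p z - inner ℝ w (u + (0 : ℝ) • z) := by
        simpa using hlt
      filter_upwards [nhdsWithin_le_nhds (hc.eventually (lt_mem_nhds h0))] with ε hε
      linarith
  filter_upwards [(Filter.eventually_all_finset V).2 key] with ε hε
  exact Finset.sup'_le _ _ hε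

/-- A point of the convex hull at which `u` is maximal lies, in any direction, not beyond the
vertices at which `u` is maximal. -/
theorem exists_argmax_inner_le (hV : V.Nonempty) {s : F} (hs : s ∈ convexHull ℝ (V : Set F))
    (hu : (inner ℝ s u : ℝ) = suppFun V hV u) (z : F) :
    ∃ m ∈ argmax V u, (inner ℝ s z : ℝ) ≤ inner ℝ m z := by
  obtain ⟨p, hp, -, hev⟩ := exists_argmax_eventually_suppFun_le hV u z
  refine ⟨p, hp, ?_⟩
  obtain ⟨ε, h, hε⟩ := (hev.and self_mem_nhdsWithin).exists
  have h1 := inner_le_suppFun_of_mem_convexHull hV hs (u + ε • z)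
  rw [inner_add_right, inner_smul_right, hu] at h1
  have : ε * inner ℝ s z ≤ ε * inner ℝ p z := by linarith
  exact le_of_mul_le_mul_left this hε

/-- Membership in a nonnegative multiple of a polytope in terms of its support function. -/
theorem mem_smul_convexHull_iff [FiniteDimensional ℝ F] (hV : V.Nonempty) {l : ℝ} (hl : 0 ≤ l)
    (y : F) : y ∈ l • convexHull ℝ (V : Set F) ↔
      ∀ u, (inner ℝ y u : ℝ) ≤ l * suppFun V hV u := by
  constructor
  · rintro ⟨p, hp, rfl⟩ u
    simp only [real_inner_smul_left]
    exact mul_le_mul_of_nonneg_left (inner_le_suppFun_of_mem_convexHull hV hp u) hl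
  · intro h
    by_contra hy
    have hconv : Convex ℝ (l • convexHull ℝ (V : Set F)) := (convex_convexHull ℝ _).smul l
    have hclosed : IsClosed (l • convexHull ℝ (V : Set F)) :=
      ((V.finite_toSet.isCompact_convexHull (𝕜 := ℝ)).smul l).isClosed
    obtain ⟨φ, c, h1, h2⟩ := geometric_hahn_banach_closed_point hconv hclosed hy
    obtain ⟨u, rfl⟩ := (InnerProductSpace.toDual ℝ F).surjective φ
    simp only [InnerProductSpace.toDual_apply_apply] at h1 h2
    obtain ⟨v, hv⟩ := argmax_nonempty hV u
    have h3 := h1 (l • v) (Set.smul_mem_smul_set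
      (subset_convexHull ℝ _ (mem_argmax.1 hv).1))
    have h4 := h u
    rw [← inner_eq_suppFun_of_mem_argmax hV hv, ← real_inner_smul_left, real_inner_comm,
      real_inner_comm u] at h4
    linarith

end SupportFunction

/-! ### Two length estimates and a maximum principle on the real line. -/

/-- If finitely many compact intervals cover `[A, B]`, their lengths add up to at least `B - A`. -/
theorem sub_le_sum_of_cover {ι : Type*} [Fintype ι] {A B : ℝ} (a b : ι → ℝ)
    (hab : ∀ i, a i ≤ b i) (h : Set.Icc A B ⊆ ⋃ i, Set.Icc (a i) (b i)) :
    B - A ≤ ∑ i, (b i - a i) := by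
  have h1 : MeasureTheory.volume (Set.Icc A B) ≤ ∑ i, MeasureTheory.volume (Set.Icc (a i) (b i)) :=
    (MeasureTheory.measure_mono h).trans (MeasureTheory.measure_iUnion_fintype_le _ _)
  simp only [Real.volume_Icc] at h1
  rw [← ENNReal.ofReal_sum_of_nonneg fun i _ => sub_nonneg.2 (hab i)] at h1
  exact (ENNReal.ofReal_le_ofReal_iff
    (Finset.sum_nonneg fun i _ => sub_nonneg.2 (hab i))).1 h1

/-- If `[A, B]` contains pairwise disjoint open intervals, their lengths add up to at most
`B - A`. -/
theorem sum_le_sub_of_disjoint {ι : Type*} [Fintype ι] {A B : ℝ} (hAB : A ≤ B) (a b : ι → ℝ)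
    (hab : ∀ i, a i ≤ b i) (hd : Pairwise (Function.onFun Disjoint fun i => Set.Ioo (a i) (b i)))
    (h : ∀ i, Set.Ioo (a i) (b i) ⊆ Set.Icc A B) :
    ∑ i, (b i - a i) ≤ B - A := by
  have h1 := MeasureTheory.measure_mono (μ := MeasureTheory.volume) (Set.iUnion_subset h)
  rw [MeasureTheory.measure_iUnion hd fun i => measurableSet_Ioo, tsum_fintype] at h1
  simp only [Real.volume_Icc, Real.volume_Ioo] at h1
  rw [← ENNReal.ofReal_sum_of_nonneg fun i _ => sub_nonneg.2 (hab i)] at h1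
  exact (ENNReal.ofReal_le_ofReal_iff (sub_nonneg.2 hAB)).1 h1

/-- A maximum principle: a continuous function on `[0, 1]` that is nonpositive at the endpoints
and nowhere strictly locally midpoint-concave is nonpositive. -/
theorem nonpos_of_local_midpoint_convex {G : ℝ → ℝ} (hG : ContinuousOn G (Set.Icc 0 1))
    (h0 : G 0 ≤ 0) (h1 : G 1 ≤ 0)
    (hloc : ∀ t ∈ Set.Ioo (0 : ℝ) 1, ∀ᶠ ε : ℝ in nhdsWithin 0 (Set.Ioi 0),
      2 * G t ≤ G (t + ε) + G (t - ε)) {t : ℝ} (ht : t ∈ Set.Icc (0 : ℝ) 1) : G t ≤ 0 := by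
  obtain ⟨m, hm, hmax⟩ := isCompact_Icc.exists_isMaxOn ⟨t, ht⟩ hG
  by_contra! hpos
  have hGm : 0 < G m := hpos.trans_le (hmax ht)
  have hcl : IsCompact (Set.Icc (0 : ℝ) 1 ∩ G ⁻¹' {G m}) :=
    isCompact_Icc.of_isClosed_subset (hG.preimage_isClosed_of_isClosed isClosed_Icc
      isClosed_singleton) Set.inter_subset_left
  -- At the leftmost maximum point the midpoint inequality forces the maximal value again at `s -
  -- ε`, further left.
  obtain ⟨s, ⟨hs, hsm⟩, hmin⟩ := hcl.exists_isLeast ⟨m, hm, rfl⟩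
  have hsm : G s = G m := hsm
  have hs0 : 0 < s := lt_of_le_of_ne hs.1 fun h => by rw [← h] at hsm; linarith
  have hs1 : s < 1 := lt_of_le_of_ne hs.2 fun h => by rw [h] at hsm; linarith
  have e1 : ∀ᶠ ε : ℝ in nhdsWithin 0 (Set.Ioi 0), ε < min s (1 - s) :=
    nhdsWithin_le_nhds (Iio_mem_nhds (lt_min hs0 (by linarith)))
  obtain ⟨ε, ⟨h2, h3⟩, h4 : 0 < ε⟩ := (((hloc s ⟨hs0, hs1⟩).and e1).and self_mem_nhdsWithin).exists
  obtain ⟨h5, h6⟩ := lt_min_iff.1 h3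
  have i1 : s - ε ∈ Set.Icc (0 : ℝ) 1 := ⟨by linarith, by linarith⟩
  have i2 : G (s + ε) ≤ G m := hmax (show s + ε ∈ Set.Icc (0 : ℝ) 1 from ⟨by linarith, by linarith⟩)
  have i3 : G (s - ε) ≤ G m := hmax i1
  have i4 : G (s - ε) = G m := by linarith
  have := hmin ⟨i1, i4⟩
  linarith

end WIP

namespace WIP

/-! ### Facet normals and normal cones of faces. -/

section NormalCone

variable {F : Type*} [NormedAddCommGroup F] [InnerProductSpace ℝ F]

theorem exists_ne_zero_orthogonal [FiniteDimensional ℝ F] {D : Submodule ℝ F}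
    (h : Module.finrank ℝ D < Module.finrank ℝ F) : ∃ z ≠ 0, ∀ x ∈ D, (inner ℝ x z : ℝ) = 0 := by
  have h1 : Dᗮ ≠ ⊥ := by
    intro h2
    have := D.finrank_add_finrank_orthogonal
    rw [h2, finrank_bot] at this
    omega
  obtain ⟨z, hz, hz0⟩ := Submodule.exists_mem_ne_zero_of_ne_bot h1
  exact ⟨z, hz0, fun x hx => hz x hx⟩

/-- `u` is an outer normal of a facet of the convex hull of `V`. -/
def IsFacetNormal (V : Finset F) (u : F) : Prop :=
  u ≠ 0 ∧ Module.finrank ℝ F ≤ Module.finrank ℝ (vectorSpan ℝ (argmax V u : Set F)) + 1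

/-- The cone of the directions that are maximal at `v₀` and constant on `M`. -/
def faceCone (V M : Finset F) (v₀ : F) : Set F :=
  {w | (∀ v ∈ V, (inner ℝ (v - v₀) w : ℝ) ≤ 0) ∧ ∀ m ∈ M, (inner ℝ (m - v₀) w : ℝ) = 0}

/-- A base of the face cone, cut out by the interior point `c`. -/
def faceConeBase (V M : Finset F) (v₀ c : F) : Set F :=
  {w | w ∈ faceCone V M v₀ ∧ (inner ℝ (v₀ - c) w : ℝ) = 1}

variable {V M : Finset F} {v₀ c : F} {r : ℝ}

/-- The point of the ball farthest in direction `w` lies in the hull, on which `w` is maximal at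
`v₀`. This keeps the slice of the cone at level 1 bounded. -/
theorem mul_norm_le_of_mem_faceCone (hr : 0 < r)
    (hball : Metric.closedBall c r ⊆ convexHull ℝ (V : Set F)) {w : F}
    (hw : w ∈ faceCone V M v₀) : r * ‖w‖ ≤ inner ℝ (v₀ - c) w := by
  by_cases h0 : w = 0
  · simp [h0]
  have hn : 0 < ‖w‖ := norm_pos_iff.2 h0
  have hmem : c + (r / ‖w‖) • w ∈ convexHull ℝ (V : Set F) := by
    apply hball
    rw [mem_closedBall_iff_norm, add_sub_cancel_left, norm_smul, Real.norm_of_nonneg (by positivity)]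
    field_simp
    exact le_rfl
  have hsub : convexHull ℝ (V : Set F) ⊆ {p | (inner ℝ p w : ℝ) ≤ inner ℝ v₀ w} := by
    refine convexHull_min (fun v hv => ?_) (convex_inner_le w _)
    have := hw.1 v hv
    rw [inner_sub_left] at this
    exact sub_nonpos.1 this
  have h1 : (inner ℝ (c + (r / ‖w‖) • w) w : ℝ) ≤ inner ℝ v₀ w := hsub hmem
  rw [inner_add_left, real_inner_smul_left, real_inner_self_eq_norm_sq] at h1
  have h2 : r / ‖w‖ * ‖w‖ ^ 2 = r * ‖w‖ := by field_simp
  rw [inner_sub_left]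
  linarith

theorem convex_faceConeBase : Convex ℝ (faceConeBase V M v₀ c) := by
  intro p hp q hq a b ha hb hab
  refine ⟨⟨fun v hv => ?_, fun m hm => ?_⟩, ?_⟩ <;>
    rw [inner_add_right, inner_smul_right, inner_smul_right]
  · have h1 := mul_nonpos_of_nonneg_of_nonpos ha (hp.1.1 v hv)
    have h2 := mul_nonpos_of_nonneg_of_nonpos hb (hq.1.1 v hv)
    linarith
  · simp [hp.1.2 m hm, hq.1.2 m hm]
  · rw [hp.2, hq.2]; linarith

variable [FiniteDimensional ℝ F]

theorem isCompact_faceConeBase (hr : 0 < r)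
    (hball : Metric.closedBall c r ⊆ convexHull ℝ (V : Set F)) :
    IsCompact (faceConeBase V M v₀ c) := by
  refine Metric.isCompact_of_isClosed_isBounded ?_ ?_
  · have h1 : faceConeBase V M v₀ c = (⋂ v ∈ V, {w | (inner ℝ (v - v₀) w : ℝ) ≤ 0}) ∩
        (⋂ m ∈ M, {w | (inner ℝ (m - v₀) w : ℝ) = 0}) ∩ {w | (inner ℝ (v₀ - c) w : ℝ) = 1} := by
      ext w
      simp [faceConeBase, faceCone]
    rw [h1]
    refine IsClosed.inter (IsClosed.inter ?_ ?_) ?_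
    · exact isClosed_biInter fun v _ => isClosed_le (by fun_prop) continuous_const
    · exact isClosed_biInter fun v _ => isClosed_eq (by fun_prop) continuous_const
    · exact isClosed_eq (by fun_prop) continuous_const
  · refine (Metric.isBounded_closedBall (x := (0 : F)) (r := 1 / r)).subset fun w hw => ?_
    have := mul_norm_le_of_mem_faceCone hr hball hw.1
    rw [hw.2] at this
    rw [mem_closedBall_zero_iff, le_div_iff₀ hr]
    linarith

/-- If the face where `w` is maximal had codimension at least 2, some `z ≠ 0` would be orthogonal to
it and to `v₀ - c`. Moving by `±ε z` preserves the tight constraints and the normalization, and the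
slack ones for small `ε`, so `w` would not be extreme. -/
theorem isFacetNormal_of_mem_extremePoints (hv₀ : v₀ ∈ V) (hM : M ⊆ V) {w : F}
    (hw : w ∈ (faceConeBase V M v₀ c).extremePoints ℝ) : IsFacetNormal V w := by
  obtain ⟨hwB, hext⟩ := mem_extremePoints.1 hw
  refine ⟨?_, ?_⟩
  · rintro rfl
    simpa using hwB.2
  by_contra! hlt
  have hv₀max : v₀ ∈ argmax V w := by
    refine mem_argmax.2 ⟨hv₀, fun v hv => ?_⟩
    have := hwB.1.1 v hv
    rw [inner_sub_left] at this
    linarith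
  set D := vectorSpan ℝ (argmax V w : Set F) with hD
  have htight : ∀ v ∈ V, (inner ℝ (v - v₀) w : ℝ) = 0 → v - v₀ ∈ D := by
    intro v hv h
    refine vsub_mem_vectorSpan ℝ (Finset.mem_coe.2 (mem_argmax.2 ⟨hv, fun x hx => ?_⟩))
      (Finset.mem_coe.2 hv₀max)
    have := hwB.1.1 x hx
    rw [inner_sub_left] at this h
    linarith
  have hfin : Module.finrank ℝ (D ⊔ Submodule.span ℝ {v₀ - c} : Submodule ℝ F) <
      Module.finrank ℝ F := by
    have h1 := Submodule.finrank_add_le_finrank_add_finrank D (Submodule.span ℝ {v₀ - c})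
    have h2 := finrank_span_le_card (R := ℝ) ({v₀ - c} : Set F)
    simp only [Set.toFinset_singleton, Finset.card_singleton] at h2
    omega
  obtain ⟨z, hz0, hz⟩ := exists_ne_zero_orthogonal hfin
  have hzD : ∀ x ∈ D, (inner ℝ x z : ℝ) = 0 := fun x hx => hz x (Submodule.mem_sup_left hx)
  have hzc : (inner ℝ (v₀ - c) z : ℝ) = 0 :=
    hz _ (Submodule.mem_sup_right (Submodule.mem_span_singleton_self _))
  have key : ∀ y : F, (∀ x ∈ D, (inner ℝ x y : ℝ) = 0) → (inner ℝ (v₀ - c) y : ℝ) = 0 →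
      ∀ᶠ ε : ℝ in nhdsWithin 0 (Set.Ioi 0), w + ε • y ∈ faceConeBase V M v₀ c := by
    intro y hyD hyc
    have h1 : ∀ v ∈ V, ∀ᶠ ε : ℝ in nhdsWithin 0 (Set.Ioi 0),
        (inner ℝ (v - v₀) (w + ε • y) : ℝ) ≤ 0 := by
      intro v hv
      rcases (hwB.1.1 v hv).lt_or_eq with h | h
      · have hc : ContinuousAt (fun ε : ℝ => (inner ℝ (v - v₀) (w + ε • y) : ℝ)) 0 := by fun_prop
        have h0 : (inner ℝ (v - v₀) (w + (0 : ℝ) • y) : ℝ) < 0 := by simpa using h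
        filter_upwards [nhdsWithin_le_nhds (hc.eventually (gt_mem_nhds h0))] with ε hε using hε.le
      · refine Filter.Eventually.of_forall fun ε => ?_
        rw [inner_add_right, inner_smul_right, hyD _ (htight v hv h), h]
        simp
    filter_upwards [(Filter.eventually_all_finset V).2 h1] with ε hε
    refine ⟨⟨hε, fun m hm => ?_⟩, ?_⟩
    · rw [inner_add_right, inner_smul_right, hwB.1.2 m hm,
        hyD _ (htight m (hM hm) (hwB.1.2 m hm))]
      simp
    · rw [inner_add_right, inner_smul_right, hyc, hwB.2]
      simp
  obtain ⟨ε, ⟨h1, h2⟩, hε : 0 < ε⟩ := (((key z hzD hzc).and (key (-z)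
    (fun x hx => by rw [inner_neg_right, hzD x hx, neg_zero])
    (by rw [inner_neg_right, hzc, neg_zero]))).and self_mem_nhdsWithin).exists
  have hseg : w ∈ openSegment ℝ (w + ε • z) (w + ε • -z) := by
    refine ⟨1 / 2, 1 / 2, by norm_num, by norm_num, by norm_num, ?_⟩
    module
  have h3 := (hext _ h1 _ h2 hseg).1
  rw [add_eq_left, smul_eq_zero] at h3
  exact h3.elim hε.ne' hz0

/-- The facet normals at a face span the orthogonal complement of the face. -/
theorem inner_eq_zero_of_forall_facetNormal (hint : (interior (convexHull ℝ (V : Set F))).Nonempty)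
    (hV : V.Nonempty) (u : F) {y : F}
    (hy : ∀ u', IsFacetNormal V u' →
      (∀ m ∈ argmax V u, ∀ m' ∈ argmax V u, (inner ℝ (m - m') u' : ℝ) = 0) →
        (inner ℝ y u' : ℝ) = 0)
    {w : F} (hw : ∀ m ∈ argmax V u, ∀ m' ∈ argmax V u, (inner ℝ (m - m') w : ℝ) = 0) :
    (inner ℝ y w : ℝ) = 0 := by
  obtain ⟨c, hc⟩ := hint
  obtain ⟨r, hr, hball⟩ := Metric.nhds_basis_closedBall.mem_iff.1 (mem_interior_iff_mem_nhds.1 hc)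
  obtain ⟨v₀, hv₀⟩ := argmax_nonempty hV u
  set M := argmax V u with hMdef
  have hMV : M ⊆ V := fun m hm => (mem_argmax.1 hm).1
  -- Krein–Milman: the compact base is the closed hull of its extreme points, all of them facet
  -- normals constant on the face.
  have hbase : ∀ x ∈ faceConeBase V M v₀ c, (inner ℝ y x : ℝ) = 0 := by
    have hsub : (faceConeBase V M v₀ c).extremePoints ℝ ⊆ {x | (inner ℝ y x : ℝ) = 0} := by
      intro x hx
      refine hy x (isFacetNormal_of_mem_extremePoints (hMV hv₀) hMV hx) fun m hm m' hm' => ?_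
      have hx' := (mem_extremePoints.1 hx).1.1.2
      rw [← sub_sub_sub_cancel_right m m' v₀, inner_sub_left, hx' m hm, hx' m' hm', sub_zero]
    have hconv : Convex ℝ {x | (inner ℝ y x : ℝ) = 0} := by
      intro p hp q hq a b _ _ _
      simp only [Set.mem_ofPred_eq, inner_add_right, inner_smul_right] at *
      simp [hp, hq]
    rw [← closure_convexHull_extremePoints (isCompact_faceConeBase hr hball) convex_faceConeBase]
    exact closure_minimal (convexHull_min hsub hconv)
      (isClosed_eq (by fun_prop) continuous_const)
  have hcone : ∀ x ∈ faceCone V M v₀, (inner ℝ y x : ℝ) = 0 := by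
    intro x hx
    by_cases h0 : x = 0
    · simp [h0]
    have hpos : 0 < (inner ℝ (v₀ - c) x : ℝ) :=
      (mul_pos hr (norm_pos_iff.2 h0)).trans_le (mul_norm_le_of_mem_faceCone hr hball hx)
    have h1 := hbase ((inner ℝ (v₀ - c) x : ℝ)⁻¹ • x) ⟨⟨fun v hv => ?_, fun m hm => ?_⟩, ?_⟩
    · rw [inner_smul_right] at h1
      exact (mul_eq_zero.1 h1).resolve_left (inv_pos.2 hpos).ne'
    · rw [inner_smul_right]
      exact mul_nonpos_of_nonneg_of_nonpos (inv_pos.2 hpos).le (hx.1 v hv)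
    · rw [inner_smul_right, hx.2 m hm, mul_zero]
    · rw [inner_smul_right, inv_mul_cancel₀ hpos.ne']
  have hMu : ∀ m ∈ M, (inner ℝ (m - v₀) u : ℝ) = 0 := fun m hm => by
    rw [inner_sub_left, inner_eq_suppFun_of_mem_argmax hV hm,
      inner_eq_suppFun_of_mem_argmax hV hv₀, sub_self]
  have hu : u ∈ faceCone V M v₀ := by
    refine ⟨fun v hv => ?_, hMu⟩
    rw [inner_sub_left]
    exact sub_nonpos.2 ((mem_argmax.1 hv₀).2 v hv)
  -- At `u` only the vertices in `M` are tight and `w` is constant on them, so `u + ε w` remains in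
  -- the cone; thus `w` is a multiple of a difference of cone elements.
  have h1 : ∀ v ∈ V, ∀ᶠ ε : ℝ in nhdsWithin 0 (Set.Ioi 0),
      (inner ℝ (v - v₀) (u + ε • w) : ℝ) ≤ 0 := by
    intro v hv
    rcases (hu.1 v hv).lt_or_eq with h | h
    · have hc : ContinuousAt (fun ε : ℝ => (inner ℝ (v - v₀) (u + ε • w) : ℝ)) 0 := by fun_prop
      have h0 : (inner ℝ (v - v₀) (u + (0 : ℝ) • w) : ℝ) < 0 := by simpa using h
      filter_upwards [nhdsWithin_le_nhds (hc.eventually (gt_mem_nhds h0))] with ε hε using hε.le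
    · have hvM : v ∈ M := by
        rw [inner_sub_left, inner_eq_suppFun_of_mem_argmax hV hv₀, sub_eq_zero] at h
        exact (mem_argmax_iff hV).2 ⟨hv, h⟩
      refine Filter.Eventually.of_forall fun ε => ?_
      rw [inner_add_right, inner_smul_right, hw v hvM v₀ hv₀, h]
      simp
  obtain ⟨ε, h2, hε : 0 < ε⟩ :=
    (((Filter.eventually_all_finset V).2 h1).and self_mem_nhdsWithin).exists
  have h3 := hcone (u + ε • w) ⟨h2, fun m hm => by
    rw [inner_add_right, inner_smul_right, hMu m hm, hw m hm v₀ hv₀]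
    simp⟩
  rw [inner_add_right, inner_smul_right, hcone u hu, zero_add] at h3
  exact (mul_eq_zero.1 h3).resolve_left hε.ne'

/-- The facet normals of a polytope with nonempty interior span the space. -/
theorem eq_zero_of_forall_facetNormal (hint : (interior (convexHull ℝ (V : Set F))).Nonempty)
    (hV : V.Nonempty) {y : F} (hy : ∀ u', IsFacetNormal V u' → (inner ℝ y u' : ℝ) = 0) :
    y = 0 := by
  -- A point `v` of largest norm is the only maximizer of the functional `v`, so its face is a
  -- single point and the face condition is vacuous.
  obtain ⟨v, hv, hmax⟩ := V.exists_max_image (fun v => ‖v‖) hV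
  have huniq : ∀ m ∈ argmax V v, m = v := by
    intro m hm
    obtain ⟨hmV, hm'⟩ := mem_argmax.1 hm
    have h1 := hm' v hv
    have h2 := hmax m hmV
    have h3 : ‖m - v‖ ^ 2 ≤ 0 := by
      rw [norm_sub_sq_real]
      rw [real_inner_self_eq_norm_sq] at h1
      have : ‖m‖ ^ 2 ≤ ‖v‖ ^ 2 := by gcongr
      linarith
    have h4 : ‖m - v‖ = 0 := by
      have := sq_nonneg ‖m - v‖
      exact pow_eq_zero_iff (two_ne_zero) |>.1 (le_antisymm h3 this)
    exact sub_eq_zero.1 (norm_eq_zero.1 h4)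
  have := inner_eq_zero_of_forall_facetNormal hint hV v (y := y) (fun u' hu' _ => hy u' hu')
    (w := y) (fun m hm m' hm' => by rw [huniq m hm, huniq m' hm']; simp)
  exact inner_self_eq_zero.1 this

/-- If `y` is dominated by the width of a collinear face in all facet normal directions, then it is
dominated by it in all directions. -/
theorem exists_inner_le_of_forall_facetNormal
    (hint : (interior (convexHull ℝ (V : Set F))).Nonempty) (hV : V.Nonempty) {u : F} {T : ℝ}
    (hT : 0 ≤ T) (hcol : Collinear ℝ (argmax V u : Set F)) {y : F}
    (hy : ∀ u', IsFacetNormal V u' → ∃ m₁ ∈ argmax V u, ∃ m₂ ∈ argmax V u,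
      |(inner ℝ y u' : ℝ)| ≤ T * inner ℝ (m₁ - m₂) u') (z : F) :
    ∃ m₁ ∈ argmax V u, ∃ m₂ ∈ argmax V u, (inner ℝ y z : ℝ) ≤ T * inner ℝ (m₁ - m₂) z := by
  obtain ⟨p₀, e, he⟩ := (collinear_iff_exists_forall_eq_smul_vadd _).1 hcol
  choose! ρ hρ using he
  obtain ⟨b, hb, hbmax⟩ := (argmax V u).exists_max_image ρ (argmax_nonempty hV u)
  obtain ⟨a, ha, hamin⟩ := (argmax V u).exists_min_image ρ (argmax_nonempty hV u)
  have hdiff : ∀ m ∈ argmax V u, ∀ m' ∈ argmax V u, m - m' = (ρ m - ρ m') • e := by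
    intro m hm m' hm'
    calc m - m' = (ρ m • e +ᵥ p₀) - (ρ m' • e +ᵥ p₀) := by rw [← hρ m hm, ← hρ m' hm']
      _ = (ρ m - ρ m') • e := by rw [vadd_eq_add, vadd_eq_add]; module
  -- A facet normal orthogonal to the edge makes the bound zero, so it annihilates `y`. Such normals
  -- span the orthogonal complement of the edge, whence `y` is parallel to `b - a`.
  have hyperp : ∀ w, (inner ℝ (b - a) w : ℝ) = 0 → (inner ℝ y w : ℝ) = 0 := by
    intro w hw
    refine inner_eq_zero_of_forall_facetNormal hint hV u (fun u' hu' hu'M => ?_) fun m hm m' hm' => ?_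
    · obtain ⟨m₁, h₁, m₂, h₂, h⟩ := hy u' hu'
      rw [hu'M _ h₁ _ h₂, mul_zero] at h
      exact abs_eq_zero.1 (le_antisymm h (abs_nonneg _))
    · rw [hdiff b hb a ha, real_inner_smul_left] at hw
      rw [hdiff m hm m' hm', real_inner_smul_left]
      rcases mul_eq_zero.1 hw with h | h
      · have h1 := hbmax m hm
        have h2 := hbmax m' hm'
        have h3 := hamin m hm
        have h4 := hamin m' hm'
        have : ρ m - ρ m' = 0 := by linarith
        rw [this, zero_mul]
      · rw [h, mul_zero]
  have hspan : y ∈ Submodule.span ℝ {b - a} := by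
    rw [← Submodule.orthogonal_orthogonal (Submodule.span ℝ {b - a}), Submodule.mem_orthogonal']
    exact fun w hw => hyperp w (Submodule.mem_orthogonal_singleton_iff_inner_right.1 hw)
  obtain ⟨l, hl⟩ := Submodule.mem_span_singleton.1 hspan
  by_cases hab : b - a = 0
  · refine ⟨b, hb, b, hb, ?_⟩
    rw [← hl, hab]
    simp
  -- One facet normal not orthogonal to the edge suffices to compare the lengths of the parallel
  -- vectors `y` and `b - a`.
  obtain ⟨u', hu', hne⟩ : ∃ u', IsFacetNormal V u' ∧ (inner ℝ (b - a) u' : ℝ) ≠ 0 := by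
    by_contra! h
    exact hab (eq_zero_of_forall_facetNormal hint hV h)
  have hlT : |l| ≤ T := by
    obtain ⟨m₁, h₁, m₂, h₂, h⟩ := hy u' hu'
    have h3 : (inner ℝ (m₁ - m₂) u' : ℝ) ≤ |(inner ℝ (b - a) u' : ℝ)| := by
      refine (le_abs_self _).trans ?_
      rw [hdiff b hb a ha, hdiff m₁ h₁ m₂ h₂, real_inner_smul_left, real_inner_smul_left, abs_mul,
        abs_mul]
      refine mul_le_mul_of_nonneg_right ?_ (abs_nonneg _)
      have i1 := hbmax m₁ h₁
      have i2 := hbmax m₂ h₂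
      have i3 := hamin m₁ h₁
      have i4 := hamin m₂ h₂
      rw [abs_of_nonneg (by linarith : 0 ≤ ρ b - ρ a), abs_le]
      constructor <;> linarith
    rw [← hl, real_inner_smul_left, abs_mul] at h
    exact le_of_mul_le_mul_right (h.trans (mul_le_mul_of_nonneg_left h3 hT)) (abs_pos.2 hne)
  have hle : (inner ℝ y z : ℝ) ≤ T * |(inner ℝ (b - a) z : ℝ)| := by
    rw [← hl, real_inner_smul_left]
    refine (le_abs_self _).trans ?_
    rw [abs_mul]
    exact mul_le_mul_of_nonneg_right hlT (abs_nonneg _)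
  rcases abs_choice (inner ℝ (b - a) z : ℝ) with h | h
  · exact ⟨b, hb, a, ha, h ▸ hle⟩
  · refine ⟨a, ha, b, hb, ?_⟩
    rwa [h, ← inner_neg_left, neg_sub] at hle

end NormalCone

end WIP

namespace WIP

/-! ### Subadditivity of a difference of support functions, and the resulting summand. -/

section Sublinear

variable {F : Type*} [NormedAddCommGroup F] [InnerProductSpace ℝ F]

/-- The points from which some segment to `b` meets, before `b`, the orthogonal complement of
`{x, y}` lie in a hyperplane. -/
theorem exists_ne_zero_generic (b : F) {x y : F} (hxy : ∀ c : ℝ, y ≠ c • x) (hx : x ≠ 0) :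
    ∃ ν : F, ν ≠ 0 ∧ ∀ a, ∀ s : ℝ, s ≠ 0 → ∀ t : ℝ, (inner ℝ x (s • a + t • b) : ℝ) = 0 →
      (inner ℝ y (s • a + t • b) : ℝ) = 0 → (inner ℝ ν a : ℝ) = 0 := by
  by_cases hb : (inner ℝ x b : ℝ) = 0
  · refine ⟨x, hx, fun a s hs t h _ => ?_⟩
    rw [inner_add_right, inner_smul_right, inner_smul_right, hb, mul_zero, add_zero] at h
    exact (mul_eq_zero.1 h).resolve_left hs
  -- This combination of `x` and `y` is orthogonal to `b`, so pairing it with `s • a + t • b`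
  -- eliminates `t`.
  · refine ⟨(inner ℝ y b : ℝ) • x - (inner ℝ x b : ℝ) • y, fun h => ?_, fun a s hs t h1 h2 => ?_⟩
    · refine hxy ((inner ℝ x b : ℝ)⁻¹ * inner ℝ y b) ?_
      rw [mul_smul, sub_eq_zero.1 h, smul_smul, inv_mul_cancel₀ hb, one_smul]
    · simp only [inner_add_right, inner_smul_right] at h1 h2
      rw [inner_sub_left, real_inner_smul_left, real_inner_smul_left]
      refine (mul_eq_zero.1 (?_ : s * _ = 0)).resolve_left hs
      linear_combination (inner ℝ y b : ℝ) * h1 - (inner ℝ x b : ℝ) * h2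

theorem dense_setOf_inner_ne_zero {ν : F} (hν : ν ≠ 0) : Dense {a : F | (inner ℝ ν a : ℝ) ≠ 0} := by
  intro a
  by_cases ha : (inner ℝ ν a : ℝ) = 0
  · have hc : Filter.Tendsto (fun ε : ℝ => a + ε • ν) (nhdsWithin 0 (Set.Ioi 0)) (nhds a) := by
      have : ContinuousAt (fun ε : ℝ => a + ε • ν) 0 := by fun_prop
      simpa [ContinuousAt] using this.tendsto.mono_left nhdsWithin_le_nhds
    refine mem_closure_of_tendsto hc ?_
    filter_upwards [self_mem_nhdsWithin] with ε (hε : 0 < ε)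
    simp only [inner_add_right, inner_smul_right, ha, zero_add]
    exact mul_ne_zero hε.ne' (inner_self_ne_zero.2 hν)
  · exact subset_closure ha

variable {V W : Finset F} {T : ℝ}

/-- `T h_V - h_W` is locally midpoint convex where only a vertex or an edge is maximal. -/
theorem eventually_two_mul_le (hV : V.Nonempty) (hW : W.Nonempty) (hT : 0 ≤ T) (u z : F)
    (h : ∀ p ∈ argmax W u, ∀ q ∈ argmax W u, ∃ m₁ ∈ argmax V u, ∃ m₂ ∈ argmax V u,
      (inner ℝ (p - q) z : ℝ) ≤ T * inner ℝ (m₁ - m₂) z) :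
    ∀ᶠ ε : ℝ in nhdsWithin 0 (Set.Ioi 0),
      2 * (T * suppFun V hV u - suppFun W hW u) ≤
        (T * suppFun V hV (u + ε • z) - suppFun W hW (u + ε • z)) +
        (T * suppFun V hV (u - ε • z) - suppFun W hW (u - ε • z)) := by
  -- The points `p` and `q` bound `h_W` from above on the two sides of `u`, while `m₁` and `m₂`
  -- bound `h_V` from below.
  obtain ⟨p, hp, -, hpε⟩ := exists_argmax_eventually_suppFun_le hW u z
  obtain ⟨q, hq, -, hqε⟩ := exists_argmax_eventually_suppFun_le hW u (-z)
  obtain ⟨m₁, h₁, m₂, h₂, hm⟩ := h p hp q hq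
  filter_upwards [hpε, hqε, self_mem_nhdsWithin] with ε h3 h4 (hε : 0 < ε)
  rw [smul_neg, ← sub_eq_add_neg, inner_neg_right] at h4
  have h5 := inner_le_suppFun hV (mem_argmax.1 h₁).1 (u + ε • z)
  have h6 := inner_le_suppFun hV (mem_argmax.1 h₂).1 (u - ε • z)
  rw [inner_add_right, inner_smul_right, inner_eq_suppFun_of_mem_argmax hV h₁] at h5
  rw [inner_sub_right, inner_smul_right, inner_eq_suppFun_of_mem_argmax hV h₂] at h6
  rw [inner_sub_left, inner_sub_left] at hm
  have h7 := mul_le_mul_of_nonneg_left h5 hT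
  have h8 := mul_le_mul_of_nonneg_left h6 hT
  have h9 := mul_le_mul_of_nonneg_left hm hε.le
  linarith

/-- Generic segments to `b` avoid, before `b`, the orthogonal complement of a pair of linearly
independent vectors. -/
theorem exists_isOpen_dense_generic (b x y : F) : ∃ U : Set F, IsOpen U ∧ Dense U ∧
    ∀ a ∈ U, ∀ s : ℝ, s ≠ 0 → ∀ t : ℝ, (inner ℝ x (s • a + t • b) : ℝ) = 0 →
      (inner ℝ y (s • a + t • b) : ℝ) = 0 → x ≠ 0 → ∃ c : ℝ, y = c • x := by
  by_cases hx : x = 0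
  · exact ⟨Set.univ, isOpen_univ, dense_univ, fun _ _ _ _ _ _ _ h => absurd hx h⟩
  by_cases hxy : ∃ c : ℝ, y = c • x
  · exact ⟨Set.univ, isOpen_univ, dense_univ, fun _ _ _ _ _ _ _ _ => hxy⟩
  push Not at hxy
  obtain ⟨ν, hν, h⟩ := exists_ne_zero_generic b hxy hx
  exact ⟨_, isOpen_ne_fun (by fun_prop) continuous_const, dense_setOf_inner_ne_zero hν,
    fun a ha s hs t h1 h2 _ => absurd (h a s hs t h1 h2) ha⟩

variable [FiniteDimensional ℝ F]

/-- For generic `a`, every functional on the segment from `a` to `b` is maximal on a vertex or an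
edge only. -/
theorem dense_collinear_argmax (V : Finset F) (b : F) :
    Dense {a : F | ∀ s : ℝ, s ≠ 0 → ∀ t : ℝ, Collinear ℝ (argmax V (s • a + t • b) : Set F)} := by
  classical
  -- One open dense condition for each of the finitely many triples in `V`: three maximizers, two of
  -- them distinct, must be collinear.
  choose U hUo hUd hU using fun q : F × F × F => exists_isOpen_dense_generic b (q.2.1 - q.1)
    (q.2.2 - q.1)
  have hd : Dense (⋂ q ∈ (V ×ˢ V ×ˢ V : Finset (F × F × F)), U q) :=
    dense_biInter_of_isOpen (S := ((V ×ˢ V ×ˢ V : Finset (F × F × F)) : Set (F × F × F)))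
      (fun q _ => hUo q) (Finset.countable_toSet _) fun q _ => hUd q
  refine hd.mono fun a ha s hs t => ?_
  by_cases hsub : ∀ m ∈ argmax V (s • a + t • b), ∀ m' ∈ argmax V (s • a + t • b), m' = m
  · have hss : (argmax V (s • a + t • b) : Set F).Subsingleton := fun m hm m' hm' =>
      hsub _ hm' _ hm
    obtain h | ⟨p, h⟩ := hss.eq_empty_or_singleton
    · exact h ▸ collinear_empty ℝ F
    · exact h ▸ collinear_singleton ℝ p
  push Not at hsub
  obtain ⟨m, hm, m', hm', hne⟩ := hsub
  refine (collinear_iff_of_mem (Finset.mem_coe.2 hm)).2 ⟨m' - m, fun p hp => ?_⟩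
  have hp := Finset.mem_coe.1 hp
  obtain ⟨hmV, -⟩ := mem_argmax.1 hm
  obtain ⟨hmV', -⟩ := mem_argmax.1 hm'
  obtain ⟨hpV, -⟩ := mem_argmax.1 hp
  have hV : V.Nonempty := ⟨m, hmV⟩
  have ha' := Set.mem_iInter₂.1 ha (m, m', p) (by simp [hmV, hmV', hpV])
  obtain ⟨c, hc⟩ := hU (m, m', p) a ha' s hs t
    (by rw [inner_sub_left, inner_eq_suppFun_of_mem_argmax hV hm,
      inner_eq_suppFun_of_mem_argmax hV hm', sub_self])
    (by rw [inner_sub_left, inner_eq_suppFun_of_mem_argmax hV hm,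
      inner_eq_suppFun_of_mem_argmax hV hp, sub_self]) (sub_ne_zero.2 hne)
  exact ⟨c, by rw [vadd_eq_add, ← hc]; simp⟩

/-- A criterion for the difference of two support functions to be subadditive: the widths of the
faces of the subtrahend in all facet normal directions are bounded by those of the minuend. -/
theorem suppFun_sub_add_le (hV : V.Nonempty) (hW : W.Nonempty) (hT : 0 ≤ T)
    (hint : (interior (convexHull ℝ (V : Set F))).Nonempty)
    (h : ∀ u u', IsFacetNormal V u' → ∀ p ∈ argmax W u, ∀ q ∈ argmax W u,
      ∃ m₁ ∈ argmax V u, ∃ m₂ ∈ argmax V u,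
        |(inner ℝ (p - q) u' : ℝ)| ≤ T * inner ℝ (m₁ - m₂) u') (a b : F) :
    T * suppFun V hV (a + b) - suppFun W hW (a + b) ≤
      (T * suppFun V hV a - suppFun W hW a) + (T * suppFun V hV b - suppFun W hW b) := by
  set f : F → ℝ := fun u => T * suppFun V hV u - suppFun W hW u with hf
  have hfc : Continuous f :=
    ((continuous_suppFun hV).const_mul T).sub (continuous_suppFun hW)
  have hclosed : IsClosed {a | f (a + b) ≤ f a + f b} :=
    isClosed_le (hfc.comp (by fun_prop)) (hfc.add continuous_const)
  -- Both sides are continuous in `a`, so generic `a` suffice. Below, `G` is `f` along the segment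
  -- minus its chord; `G (1/2) ≤ 0` gives the claim by homogeneity.
  refine closure_minimal (fun a ha => ?_) hclosed (dense_collinear_argmax V b a)
  let G : ℝ → ℝ := fun t => f ((1 - t) • a + t • b) - ((1 - t) * f a + t * f b)
  have hGc : Continuous G := (hfc.comp (by fun_prop)).sub (by fun_prop)
  have hG := nonpos_of_local_midpoint_convex (G := G) hGc.continuousOn (by simp [G]) (by simp [G])
    (fun t ht => ?_) (t := 1 / 2) ⟨by norm_num, by norm_num⟩
  · have h2 : f (a + b) = 2 * f ((1 - 1 / 2 : ℝ) • a + (1 / 2 : ℝ) • b) := by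
      have h3 : a + b = (2 : ℝ) • ((1 - 1 / 2 : ℝ) • a + (1 / 2 : ℝ) • b) := by module
      simp only [hf]
      rw [h3, suppFun_smul hV zero_le_two, suppFun_smul hW zero_le_two]
      ring
    simp only [G] at hG
    change f (a + b) ≤ f a + f b
    linarith
  · have hcol := ha (1 - t) (by linarith [ht.2]) t
    filter_upwards [eventually_two_mul_le hV hW hT ((1 - t) • a + t • b) (b - a)
      fun p hp q hq => exists_inner_le_of_forall_facetNormal hint hV hT hcol
        (fun u' hu' => h _ u' hu' p hp q hq) (b - a)] with ε hε
    have e1 : (1 - t) • a + t • b + ε • (b - a) = (1 - (t + ε)) • a + (t + ε) • b := by module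
    have e2 : (1 - t) • a + t • b - ε • (b - a) = (1 - (t - ε)) • a + (t - ε) • b := by module
    rw [e1, e2] at hε
    simp only [G, hf]
    linarith

/-- If the difference of the support functions of two polytopes is subadditive, the difference is
the support function of a complementary summand. -/
theorem exists_add_eq_of_suppFun_sub_add_le (hV : V.Nonempty) (hW : W.Nonempty) (hT : 0 ≤ T)
    (h : ∀ a b, T * suppFun V hV (a + b) - suppFun W hW (a + b) ≤
      (T * suppFun V hV a - suppFun W hW a) + (T * suppFun V hV b - suppFun W hW b)) :
    ∃ K : Set F, K.Nonempty ∧ IsCompact K ∧ Convex ℝ K ∧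
      convexHull ℝ (W : Set F) + K = T • convexHull ℝ (V : Set F) := by
  set f : F → ℝ := fun u => T * suppFun V hV u - suppFun W hW u with hf
  have hfsmul : ∀ r : ℝ, 0 ≤ r → ∀ u, f (r • u) = r * f u := by
    intro r hr u
    simp only [hf]
    rw [suppFun_smul hV hr, suppFun_smul hW hr]
    ring
  let K : Set F := {y | ∀ u, (inner ℝ y u : ℝ) ≤ f u}
  -- Extend `c • u ↦ c * f u` from a line to a linear functional dominated by `f`; its Riesz vector
  -- lies in `K` and attains `f u`.
  have hsupp : ∀ u, ∃ y ∈ K, (inner ℝ y u : ℝ) = f u := by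
    intro u
    have hf0 : f 0 = 0 := by simpa using hfsmul 0 le_rfl 0
    have hker : ∀ c : ℝ, c • u = 0 → c • f u = 0 := by
      intro c hc
      rcases smul_eq_zero.1 hc with h | h
      · simp [h]
      · simp [h, hf0]
    obtain ⟨g, hg1, hg2⟩ := exists_extension_of_le_sublinear
      (LinearPMap.mkSpanSingleton' u (f u) hker) f
      (fun c hc x => hfsmul c hc.le x) h (by
        rintro ⟨x, hx⟩
        obtain ⟨c, rfl⟩ := Submodule.mem_span_singleton.1 hx
        rw [LinearPMap.mkSpanSingleton'_apply, smul_eq_mul]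
        change c * f u ≤ f (c • u)
        rcases le_total 0 c with hc | hc
        · rw [hfsmul c hc]
        -- For negative `c`, domination on the line is `0 = f 0 ≤ f (c • u) + f (-c • u)`.
        · have h1 := hfsmul (-c) (by linarith) u
          have h2 := h (c • u) ((-c) • u)
          change f _ ≤ f _ + f _ at h2
          rw [← add_smul, add_neg_cancel, zero_smul, hf0] at h2
          linarith)
    obtain ⟨y, hy⟩ := (InnerProductSpace.toDual ℝ F).surjective (LinearMap.toContinuousLinearMap g)
    have hy' : ∀ x, (inner ℝ y x : ℝ) = g x := fun x => by
      rw [← InnerProductSpace.toDual_apply_apply, hy]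
      rfl
    refine ⟨y, fun x => (hy' x).trans_le (hg2 x), ?_⟩
    rw [hy']
    have := hg1 ⟨u, Submodule.mem_span_singleton_self u⟩
    simp only at this
    rw [this]
    exact LinearPMap.mkSpanSingleton'_apply_self u (f u) hker _
  have hKconv : Convex ℝ K := by
    intro p hp q hq a b ha hb hab u
    exact convex_inner_le u (f u) (hp u) (hq u) ha hb hab
  have hKclosed : IsClosed K := by
    have : K = ⋂ u, {y | (inner ℝ y u : ℝ) ≤ f u} := by ext; simp [K]
    rw [this]
    exact isClosed_iInter fun u => isClosed_le (by fun_prop) continuous_const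
  have hsub : convexHull ℝ (W : Set F) + K ⊆ T • convexHull ℝ (V : Set F) := by
    rintro _ ⟨q, hq, y, hy, rfl⟩
    refine (mem_smul_convexHull_iff hV hT _).2 fun u => ?_
    have h1 := inner_le_suppFun_of_mem_convexHull hW hq u
    have h2 := hy u
    simp only [hf] at h2
    rw [inner_add_left]
    linarith
  have hVc : IsCompact (T • convexHull ℝ (V : Set F)) :=
    (V.finite_toSet.isCompact_convexHull (𝕜 := ℝ)).smul T
  have hKc : IsCompact K := by
    obtain ⟨w, hw⟩ := hW
    refine (hVc.image (continuous_id.sub continuous_const : Continuous fun x => x - w)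
      ).of_isClosed_subset hKclosed fun y hy => ?_
    exact ⟨w + y, hsub (Set.add_mem_add (subset_convexHull ℝ _ hw) hy), by simp⟩
  refine ⟨K, ?_, hKc, hKconv, hsub.antisymm fun x hx => ?_⟩
  · obtain ⟨y, hy, -⟩ := hsupp 0
    exact ⟨y, hy⟩
  -- A point left over would be separated by some `u`, although the support functions satisfy `h_W +
  -- f = T h_V`.
  by_contra hxn
  obtain ⟨φ, c, h1, h2⟩ := geometric_hahn_banach_closed_point ((convex_convexHull ℝ _).add hKconv)
    ((W.finite_toSet.isCompact_convexHull (𝕜 := ℝ)).add hKc).isClosed hxn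
  obtain ⟨u, rfl⟩ := (InnerProductSpace.toDual ℝ F).surjective φ
  simp only [InnerProductSpace.toDual_apply_apply] at h1 h2
  obtain ⟨w, hw⟩ := argmax_nonempty hW u
  obtain ⟨y, hy, hyu⟩ := hsupp u
  have h3 := h1 _ (Set.add_mem_add (subset_convexHull ℝ _ (mem_argmax.1 hw).1) hy)
  have h4 := (mem_smul_convexHull_iff hV hT x).1 hx u
  rw [inner_add_right, real_inner_comm, real_inner_comm y, hyu,
    inner_eq_suppFun_of_mem_argmax hW hw] at h3
  rw [real_inner_comm] at h2
  simp only [hf] at h3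
  linarith

end Sublinear

end WIP

/-! ### From impassability to face widths, and the summand property. -/

namespace WIP

/-- The orthogonal complement of two vectors has codimension at most 2; this is where `k ≤ d - 2`
enters. -/
theorem exists_submodule_finrank_eq {F : Type*} [NormedAddCommGroup F] [InnerProductSpace ℝ F]
    [FiniteDimensional ℝ F] {k : ℕ} (hk : k + 2 ≤ Module.finrank ℝ F) (u u' : F) :
    ∃ D : Submodule ℝ F, Module.finrank ℝ D = k ∧
      ∀ z ∈ D, (inner ℝ z u : ℝ) = 0 ∧ (inner ℝ z u' : ℝ) = 0 := by
  classical
  set S := (Submodule.span ℝ (({u, u'} : Finset F) : Set F))ᗮ with hS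
  have h1 : k ≤ Module.finrank ℝ S := by
    have h2 := finrank_span_finset_le_card (R := ℝ) ({u, u'} : Finset F)
    have h3 := Finset.card_le_two (a := u) (b := u')
    have h4 := (Submodule.span ℝ (({u, u'} : Finset F) : Set F)).finrank_add_finrank_orthogonal
    rw [Set.finrank] at h2
    rw [← hS] at h4
    omega
  obtain ⟨f, hf⟩ := exists_linearIndependent_of_le_finrank h1
  have hf' : LinearIndependent ℝ (fun i => (f i : F)) :=
    hf.map' S.subtype (Submodule.ker_subtype S)
  refine ⟨Submodule.span ℝ (Set.range fun i => (f i : F)), ?_, fun z hz => ?_⟩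
  · rw [finrank_span_eq_card hf', Fintype.card_fin]
  · have hzS : z ∈ S := Submodule.span_le.2 (by rintro _ ⟨i, rfl⟩; exact (f i).2) hz
    rw [hS, Submodule.mem_orthogonal'] at hzS
    exact ⟨hzS u (Submodule.subset_span (by simp)), hzS u' (Submodule.subset_span (by simp))⟩

variable {d k n : ℕ}

/-- The span of the face exposed by `u` lies between that of the maximal vertices and the hyperplane
orthogonal to `u`; these have equal dimension. -/
theorem exists_isFacet_of_isFacetNormal {V : Finset (E d)} (hV : V.Nonempty) {u : E d}
    (hu : IsFacetNormal V u) : ∃ F : Set (E d), IsFacet (convexHull ℝ (V : Set (E d))) F ∧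
      ∀ z : E d, (inner ℝ z u : ℝ) = 0 → z ∈ vectorSpan ℝ F := by
  set P := convexHull ℝ (V : Set (E d)) with hP
  set F : Set (E d) := {p | p ∈ P ∧ ∀ y ∈ P, InnerProductSpace.toDual ℝ (E d) u y ≤
    InnerProductSpace.toDual ℝ (E d) u p} with hF
  have hsub : (argmax V u : Set (E d)) ⊆ F := by
    intro m hm
    have hm := Finset.mem_coe.1 hm
    refine ⟨subset_convexHull ℝ _ (mem_argmax.1 hm).1, fun y hy => ?_⟩
    simp only [InnerProductSpace.toDual_apply_apply]
    rw [real_inner_comm, real_inner_comm m, inner_eq_suppFun_of_mem_argmax hV hm]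
    exact inner_le_suppFun_of_mem_convexHull hV hy u
  have hle : vectorSpan ℝ F ≤ (Submodule.span ℝ {u})ᗮ := by
    rw [vectorSpan_def, Submodule.span_le]
    rintro _ ⟨p, hp, q, hq, rfl⟩
    have h1 := hp.2 q hq.1
    have h2 := hq.2 p hp.1
    simp only [InnerProductSpace.toDual_apply_apply] at h1 h2
    rw [SetLike.mem_coe, Submodule.mem_orthogonal_singleton_iff_inner_right]
    simp only [vsub_eq_sub, inner_sub_right]
    linarith
  have h1 : Module.finrank ℝ (Submodule.span ℝ {u})ᗮ + 1 = d := by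
    have h2 := (Submodule.span ℝ {u}).finrank_add_finrank_orthogonal
    rw [finrank_span_singleton hu.1, finrank_euclideanSpace_fin] at h2
    omega
  have h2 := hu.2
  rw [finrank_euclideanSpace_fin] at h2
  have h3 := Submodule.finrank_mono (vectorSpan_mono ℝ hsub)
  have h4 := Submodule.finrank_mono hle
  have heq : vectorSpan ℝ F = (Submodule.span ℝ {u})ᗮ :=
    Submodule.eq_of_le_of_finrank_eq hle (by omega)
  refine ⟨F, ⟨?_, fun _ => ⟨InnerProductSpace.toDual ℝ (E d) u, rfl⟩, by omega⟩, fun z hz => ?_⟩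
  · obtain ⟨m, hm⟩ := argmax_nonempty hV u
    exact ⟨m, hsub hm⟩
  · rw [heq, Submodule.mem_orthogonal_singleton_iff_inner_left]
    exact hz

/-- In a weakly `k`-impassable family with `k ≤ d - 2`, every point of the convex hull is matched
by a point of a member in every functional together with every facet normal. -/
theorem IsWIP.exists_mem_homothet (hkd : k + 2 ≤ d) {V : Finset (E d)} (hV : V.Nonempty)
    {x : Fin n → E d} {τ : Fin n → ℝ} (h : IsWIP k (convexHull ℝ (V : Set (E d))) x τ)
    (u : E d) {u' : E d} (hu' : IsFacetNormal V u') {p : E d}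
    (hp : p ∈ convexHull ℝ (familyUnion (convexHull ℝ (V : Set (E d))) x τ)) :
    ∃ i, ∃ r ∈ homothet (convexHull ℝ (V : Set (E d))) x τ i,
      (inner ℝ r u : ℝ) = inner ℝ p u ∧ (inner ℝ r u' : ℝ) = inner ℝ p u' := by
  obtain ⟨D, hD, hDu⟩ := exists_submodule_finrank_eq
    (by rwa [finrank_euclideanSpace_fin] : k + 2 ≤ Module.finrank ℝ (E d)) u u'
  obtain ⟨F, hF, hFu⟩ := exists_isFacet_of_isFacetNormal hV hu'
  obtain ⟨f, hf⟩ := hF.1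
  -- The flat `p + D` is parallel to the facet with normal `u'`, and both functionals are constant
  -- on it.
  obtain ⟨i, r, hrL, hr⟩ := h (AffineSubspace.mk' p D)
    (by rw [AffineSubspace.direction_mk', hD])
    ⟨F, hF, f - p, by
      rintro _ ⟨y, hy, rfl⟩
      have hy' : y - p ∈ D := AffineSubspace.mem_mk'.1 hy
      have h1 : y - p ∈ (affineSpan ℝ F).direction := by
        rw [direction_affineSpan]
        exact hFu _ (hDu _ hy').2
      have h2 := AffineSubspace.vadd_mem_of_mem_direction h1 (mem_affineSpan ℝ hf)
      rw [vadd_eq_add] at h2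
      have h3 : (f - p) +ᵥ y = y - p + f := by rw [vadd_eq_add]; abel
      change (f - p) +ᵥ y ∈ affineSpan ℝ F
      rwa [h3]⟩
    ⟨p, AffineSubspace.self_mem_mk' p D, hp⟩
  have hrD : r - p ∈ D := AffineSubspace.mem_mk'.1 hrL
  obtain ⟨h1, h2⟩ := hDu _ hrD
  rw [inner_sub_left, sub_eq_zero] at h1 h2
  exact ⟨i, r, hr, h1, h2⟩

open Classical in
/-- The vertices of the members of a family of homothets of the convex hull of `V`. -/
noncomputable def familyVertices (V : Finset (E d)) (x : Fin n → E d) (τ : Fin n → ℝ) :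
    Finset (E d) :=
  Finset.univ.biUnion fun i => V.image fun v => x i + τ i • v

theorem mem_familyVertices {V : Finset (E d)} {x : Fin n → E d} {τ : Fin n → ℝ} {p : E d} :
    p ∈ familyVertices V x τ ↔ ∃ i, ∃ v ∈ V, x i + τ i • v = p := by
  classical
  simp [familyVertices]

theorem homothet_convexHull (V : Set (E d)) (x : Fin n → E d) (τ : Fin n → ℝ) (i : Fin n) :
    homothet (convexHull ℝ V) x τ i = convexHull ℝ (homothet V x τ i) := by
  rw [homothet, homothet, convexHull_vadd, convexHull_smul]

theorem convexHull_familyUnion (V : Finset (E d)) (x : Fin n → E d) (τ : Fin n → ℝ) :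
    convexHull ℝ (familyUnion (convexHull ℝ (V : Set (E d))) x τ) =
      convexHull ℝ (familyVertices V x τ : Set (E d)) := by
  apply Set.Subset.antisymm
  · refine convexHull_min (Set.iUnion_subset fun i => ?_) (convex_convexHull ℝ _)
    rw [homothet_convexHull]
    refine convexHull_mono ?_
    rintro _ ⟨_, ⟨v, hv, rfl⟩, rfl⟩
    exact Finset.mem_coe.2 (mem_familyVertices.2 ⟨i, v, hv, rfl⟩)
  · refine convexHull_mono fun p hp => ?_
    obtain ⟨i, v, hv, rfl⟩ := mem_familyVertices.1 (Finset.mem_coe.1 hp)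
    exact Set.mem_iUnion.2 ⟨i, τ i • v, ⟨v, subset_convexHull ℝ _ hv, rfl⟩, rfl⟩

end WIP

namespace WIP

variable {d k n : ℕ} {V : Finset (E d)} {x : Fin n → E d} {τ : Fin n → ℝ}

/-- The faces of the convex hull of a weakly `k`-impassable family are bounded, in facet normal
directions, by the faces of the polytope. -/
theorem IsWIP.abs_inner_sub_le (hkd : k + 2 ≤ d) (hV : V.Nonempty) (hτ : ∀ i, 0 < τ i)
    (h : IsWIP k (convexHull ℝ (V : Set (E d))) x τ) (hW : (familyVertices V x τ).Nonempty)
    {u u' : E d} (hu' : IsFacetNormal V u') {p q : E d} (hp : p ∈ argmax (familyVertices V x τ) u)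
    (hq : q ∈ argmax (familyVertices V x τ) u) :
    ∃ m₁ ∈ argmax V u, ∃ m₂ ∈ argmax V u,
      |(inner ℝ (p - q) u' : ℝ)| ≤ (∑ i, τ i) * inner ℝ (m₁ - m₂) u' := by
  obtain ⟨m₁, h₁, hmax⟩ := (argmax V u).exists_max_image (fun v => (inner ℝ v u' : ℝ))
    (argmax_nonempty hV u)
  obtain ⟨m₂, h₂, hmin⟩ := (argmax V u).exists_min_image (fun v => (inner ℝ v u' : ℝ))
    (argmax_nonempty hV u)
  refine ⟨m₁, h₁, m₂, h₂, ?_⟩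
  -- The matched point `x i + τ i • y` reaches the maximum of `u` over the whole hull, so `y` lies
  -- in the `u`-face of `P`, whose `u'`-range is bounded by `m₂` and `m₁`.
  have hslice : ∀ s ∈ convexHull ℝ (familyVertices V x τ : Set (E d)),
      (inner ℝ s u : ℝ) = suppFun _ hW u → ∃ i, (inner ℝ s u' : ℝ) ∈
        Set.Icc (inner ℝ (x i) u' + τ i * inner ℝ m₂ u') (inner ℝ (x i) u' + τ i * inner ℝ m₁ u') := by
    intro s hs hsu
    obtain ⟨i, _, ⟨_, ⟨y, hy, rfl⟩, rfl⟩, hr1, hr2⟩ := h.exists_mem_homothet hkd hV u hu'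
      (p := s) (by rwa [convexHull_familyUnion])
    simp only [vadd_eq_add, inner_add_left, real_inner_smul_left] at hr1 hr2
    have hyu : (inner ℝ y u : ℝ) = suppFun V hV u := by
      refine le_antisymm (inner_le_suppFun_of_mem_convexHull hV hy u) ?_
      have h1 := inner_le_suppFun hW (mem_familyVertices.2 ⟨i, m₁, (mem_argmax.1 h₁).1, rfl⟩) u
      rw [inner_add_left, real_inner_smul_left, inner_eq_suppFun_of_mem_argmax hV h₁, ← hsu,
        ← hr1] at h1
      exact le_of_mul_le_mul_left (by linarith) (hτ i)
    obtain ⟨m, hm, hmy⟩ := exists_argmax_inner_le hV hy hyu u'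
    obtain ⟨m', hm', hmy'⟩ := exists_argmax_inner_le hV hy hyu (-u')
    rw [inner_neg_right, inner_neg_right] at hmy'
    refine ⟨i, ?_, ?_⟩ <;> rw [← hr2]
    · have := mul_le_mul_of_nonneg_left ((hmin m' hm').trans (neg_le_neg_iff.1 hmy')) (hτ i).le
      linarith
    · have := mul_le_mul_of_nonneg_left (hmy.trans (hmax m hm)) (hτ i).le
      linarith
  have hle : ∀ p ∈ argmax (familyVertices V x τ) u, ∀ q ∈ argmax (familyVertices V x τ) u,
      (inner ℝ (p - q) u' : ℝ) ≤ (∑ i, τ i) * inner ℝ (m₁ - m₂) u' := by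
    intro p hp q hq
    have hm : (inner ℝ m₂ u' : ℝ) ≤ inner ℝ m₁ u' := hmax m₂ h₂
    -- The segment from `q` to `p` stays in the `u`-face of the hull, so its projection is covered
    -- by the intervals of `hslice`.
    have hcov : Set.Icc (inner ℝ q u' : ℝ) (inner ℝ p u') ⊆
        ⋃ i, Set.Icc (inner ℝ (x i) u' + τ i * inner ℝ m₂ u')
          (inner ℝ (x i) u' + τ i * inner ℝ m₁ u') := by
      intro c hc
      have hc' : c ∈ segment ℝ (inner ℝ q u' : ℝ) (inner ℝ p u') := by
        rwa [segment_eq_Icc (hc.1.trans hc.2)]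
      obtain ⟨a, b, ha, hb, hab, rfl⟩ := hc'
      obtain ⟨i, hi⟩ := hslice (a • q + b • p)
        (convex_convexHull ℝ _ (subset_convexHull ℝ _ (mem_argmax.1 hq).1)
          (subset_convexHull ℝ _ (mem_argmax.1 hp).1) ha hb hab) (by
          rw [inner_add_left, real_inner_smul_left, real_inner_smul_left,
            inner_eq_suppFun_of_mem_argmax hW hp, inner_eq_suppFun_of_mem_argmax hW hq, ← add_mul,
            hab, one_mul])
      rw [inner_add_left, real_inner_smul_left, real_inner_smul_left] at hi
      exact Set.mem_iUnion.2 ⟨i, hi⟩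
    have := sub_le_sum_of_cover _ _ (fun i => by
      have := mul_le_mul_of_nonneg_left hm (hτ i).le
      linarith) hcov
    rw [inner_sub_left, inner_sub_left, Finset.sum_mul]
    refine this.trans_eq (Finset.sum_congr rfl fun i _ => by ring)
  rw [abs_le']
  refine ⟨hle p hp q hq, ?_⟩
  rw [← inner_neg_left, neg_sub]
  exact hle q hq p hp

theorem IsWIP.isSummand (hkd : k + 2 ≤ d) (hn : 0 < n) (hV : V.Nonempty)
    (hint : (interior (convexHull ℝ (V : Set (E d)))).Nonempty) (hτ : ∀ i, 0 < τ i)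
    (h : IsWIP k (convexHull ℝ (V : Set (E d))) x τ) :
    IsSummand (convexHull ℝ (familyUnion (convexHull ℝ (V : Set (E d))) x τ))
      ((∑ i, τ i) • convexHull ℝ (V : Set (E d))) := by
  have hW : (familyVertices V x τ).Nonempty := by
    obtain ⟨v, hv⟩ := hV
    exact ⟨_, mem_familyVertices.2 ⟨⟨0, hn⟩, v, hv, rfl⟩⟩
  have hT : 0 ≤ ∑ i, τ i := Finset.sum_nonneg fun i _ => (hτ i).le
  rw [convexHull_familyUnion]
  exact exists_add_eq_of_suppFun_sub_add_le hV hW hT (suppFun_sub_add_le hV hW hT hint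
    fun u u' hu' p hp q hq => h.abs_inner_sub_le hkd hV hτ hW hu' hp hq)

/-- Write `p = q + y` with `y` in the complementary summand; translation by `y` works. -/
theorem IsSummand.slidesFreely {K₁ K₂ : Set (E d)} (hK₁ : IsClosed K₁) (h : IsSummand K₂ K₁) :
    SlidesFreely K₂ K₁ := by
  obtain ⟨K, -, -, -, rfl⟩ := h
  intro p hp
  obtain ⟨q, hq, y, hy, rfl⟩ := hK₁.frontier_subset hp
  refine ⟨y, ⟨q, hq, add_comm y q⟩, ?_⟩
  rintro _ ⟨z, hz, rfl⟩
  exact ⟨z, hz, y, hy, add_comm z y⟩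

theorem IsSummand.one_mem_coverFactors {P : Set (E d)}
    (h : IsSummand (convexHull ℝ (familyUnion P x τ)) ((∑ i, τ i) • P)) :
    (1 : ℝ) ∈ coverFactors P x τ := by
  obtain ⟨K, ⟨y, hy⟩, -, -, hK⟩ := h
  refine ⟨one_pos, -y, fun p hp => ?_⟩
  rw [one_mul, ← hK]
  exact ⟨p + y, ⟨p, subset_convexHull ℝ _ hp, y, hy, rfl⟩, by simp⟩

/-! ### Existence of the minimum defining `Λ`. -/

/-- The smallest cover factor exists if there is one at all. -/
theorem isLeast_coverFactors (hn : 0 < n) (hV : V.Nonempty)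
    (hint : (interior (convexHull ℝ (V : Set (E d)))).Nonempty) (hd : 0 < d) (hτ : ∀ i, 0 < τ i)
    (hne : (coverFactors (convexHull ℝ (V : Set (E d))) x τ).Nonempty) :
    IsLeast (coverFactors (convexHull ℝ (V : Set (E d))) x τ)
      (Lam (convexHull ℝ (V : Set (E d))) x τ) := by
  set P := convexHull ℝ (V : Set (E d)) with hP
  set T := ∑ i, τ i with hTdef
  have hT : 0 ≤ T := Finset.sum_nonneg fun i _ => (hτ i).le
  obtain ⟨l₀, hl₀, t₀, ht₀⟩ := hne
  have hPc : IsCompact P := V.finite_toSet.isCompact_convexHull (𝕜 := ℝ)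
  have hPne : P.Nonempty := hint.mono interior_subset
  -- Pairs (factor, translation) below a known factor. Support function inequalities make `S`
  -- visibly closed, and `l = 0` is admitted for compactness and excluded afterwards.
  let S : Set (ℝ × E d) := {q | q.1 ∈ Set.Icc 0 l₀ ∧
    ∀ p ∈ familyUnion P x τ, ∀ u, (inner ℝ (p - q.2) u : ℝ) ≤ q.1 * T * suppFun V hV u}
  have hmemS : ∀ l ∈ Set.Icc 0 l₀, ∀ t, (l, t) ∈ S ↔ familyUnion P x τ ⊆ t +ᵥ (l * T) • P := by
    intro l hl t
    have : (l, t) ∈ S ↔ ∀ p ∈ familyUnion P x τ, p - t ∈ (l * T) • P := by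
      simp only [S, hP, mem_smul_convexHull_iff hV (mul_nonneg hl.1 hT)]
      exact ⟨fun h => h.2, fun h => ⟨hl, h⟩⟩
    rw [this]
    refine forall₂_congr fun p _ => ?_
    rw [Set.mem_vadd_set_iff_neg_vadd_mem, vadd_eq_add, neg_add_eq_sub]
  have hSclosed : IsClosed S := by
    have : S = (Prod.fst ⁻¹' Set.Icc 0 l₀) ∩ ⋂ p ∈ familyUnion P x τ, ⋂ u : E d,
        {q : ℝ × E d | (inner ℝ (p - q.2) u : ℝ) ≤ q.1 * T * suppFun V hV u} := by
      ext q
      simp [S]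
    rw [this]
    exact (isClosed_Icc.preimage continuous_fst).inter (isClosed_biInter fun p _ =>
      isClosed_iInter fun u => isClosed_le (by fun_prop) (by fun_prop))
  obtain ⟨c, hc⟩ := hPne
  obtain ⟨p₀, hp₀⟩ : (familyUnion P x τ).Nonempty :=
    ⟨_, Set.mem_iUnion.2 ⟨⟨0, hn⟩, _, ⟨c, hc, rfl⟩, rfl⟩⟩
  have hScompact : IsCompact S := by
    have hcomp : IsCompact ((fun q : ℝ × E d => (q.1, p₀ - (q.1 * T) • q.2)) ''
        (Set.Icc 0 l₀ ×ˢ P)) := (isCompact_Icc.prod hPc).image (by fun_prop)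
    refine hcomp.of_isClosed_subset hSclosed ?_
    rintro ⟨l, t⟩ hq
    have hl : l ∈ Set.Icc 0 l₀ := hq.1
    obtain ⟨_, ⟨y, hy, rfl⟩, h2⟩ := (hmemS l hl t).1 hq hp₀
    refine ⟨(l, y), ⟨hl, hy⟩, ?_⟩
    rw [← h2]
    simp
  have hSne : (l₀, t₀) ∈ S := (hmemS l₀ ⟨hl₀.le, le_rfl⟩ t₀).2 ht₀
  obtain ⟨⟨l, t⟩, hlS, hlmin⟩ := hScompact.exists_isMinOn ⟨_, hSne⟩ continuous_fst.continuousOn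
  have hl : l ∈ Set.Icc 0 l₀ := hlS.1
  have hcover := (hmemS l hl t).1 hlS
  -- Factor 0 would squeeze a member, hence `P`, into one point, contradicting its nonempty
  -- interior.
  have hlpos : 0 < l := by
    refine lt_of_le_of_ne hl.1 fun h0 => ?_
    have hPsub : P.Subsingleton := by
      intro a ha b hb
      have key : ∀ a ∈ P, x ⟨0, hn⟩ + τ ⟨0, hn⟩ • a = t := by
        intro a ha
        obtain ⟨_, ⟨y, -, rfl⟩, h2⟩ := hcover (Set.mem_iUnion.2 ⟨⟨0, hn⟩, _, ⟨a, ha, rfl⟩, rfl⟩)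
        simp only [← h0, zero_mul, zero_smul, vadd_eq_add, add_zero] at h2
        exact h2.symm
      have h3 := (key a ha).trans (key b hb).symm
      exact smul_right_injective _ (hτ ⟨0, hn⟩).ne' (add_left_cancel h3)
    have : Nontrivial (E d) := by
      have : Nonempty (Fin d) := ⟨⟨0, hd⟩⟩
      infer_instance
    obtain ⟨b, hb⟩ := hint
    have h4 := (hPsub.anti interior_subset).eq_singleton_of_mem hb
    exact not_isOpen_singleton b (h4 ▸ isOpen_interior)
  have hleast : IsLeast (coverFactors P x τ) l := by
    refine ⟨⟨hlpos, t, hcover⟩, ?_⟩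
    rintro l' ⟨hl', t', ht'⟩
    rcases le_total l₀ l' with h | h
    · exact hl.2.trans h
    · exact hlmin ((hmemS l' ⟨hl'.le, h⟩ t').2 ht')
  rw [Lam, hleast.csInf_eq]
  exact hleast

end WIP

/-! ### Rows of cubes. -/

namespace WIP

variable {d n : ℕ} {b : OrthonormalBasis (Fin d) ℝ (E d)} {c : E d} {s : ℝ}

theorem convex_box (w : Fin d → ℝ) : Convex ℝ (box b c w) := by
  intro p hp q hq α β hα hβ hαβ j
  have h : α • p + β • q - c = α • (p - c) + β • (q - c) := by
    have : c = α • c + β • c := by rw [← add_smul, hαβ, one_smul]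
    nth_rewrite 1 [this]
    module
  rw [h, inner_add_right, inner_smul_right, inner_smul_right]
  refine (abs_add_le _ _).trans ?_
  rw [abs_mul, abs_mul, abs_of_nonneg hα, abs_of_nonneg hβ]
  calc _ ≤ α * (w j / 2) + β * (w j / 2) := by
        gcongr
        · exact hp j
        · exact hq j
    _ = w j / 2 := by rw [← add_mul, hαβ, one_mul]

theorem isOpen_openBox (b : OrthonormalBasis (Fin d) ℝ (E d)) (c : E d) (s : ℝ) :
    IsOpen {p : E d | ∀ j, |(inner ℝ (b j) (p - c) : ℝ)| < s / 2} := by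
  simp only [Set.ofPred_forall]
  exact isOpen_iInter_of_finite fun j => isOpen_lt (by fun_prop) continuous_const

theorem mem_interior_box {p : E d} (hp : ∀ j, |(inner ℝ (b j) (p - c) : ℝ)| < s / 2) :
    p ∈ interior (box b c fun _ => s) :=
  interior_maximal (fun _ hq j => (hq j).le) (isOpen_openBox b c s) hp

theorem finite_finsetSum_sets {ι M : Type*} [AddCommMonoid M] (t : Finset ι) (A : ι → Set M)
    (h : ∀ i, (A i).Finite) : (∑ i ∈ t, A i).Finite := by
  classical
  induction t using Finset.induction_on with
  | empty => simp
  | insert i t hi ih => rw [Finset.sum_insert hi]; exact (h i).add ih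

/-- Exhibits the cube as the convex hull of a finite set, since parallelepipeds are. -/
theorem box_eq_vadd_parallelepiped (hs : 0 < s) :
    box b c (fun _ => s) = (c - ∑ j, (s / 2) • b j) +ᵥ parallelepiped fun j => s • b j := by
  ext p
  rw [Set.mem_vadd_set_iff_neg_vadd_mem, mem_parallelepiped_iff]
  constructor
  · intro hp
    refine ⟨fun j => inner ℝ (b j) (p - c) / s + 1 / 2, ⟨fun j => ?_, fun j => ?_⟩, ?_⟩
    · have := (abs_le.1 (hp j)).1
      simp only [Pi.zero_apply]
      have h1 : -(1 / 2) ≤ (inner ℝ (b j) (p - c) : ℝ) / s := by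
        rw [le_div_iff₀ hs]; linarith
      linarith
    · have := (abs_le.1 (hp j)).2
      simp only [Pi.one_apply]
      have h1 : (inner ℝ (b j) (p - c) : ℝ) / s ≤ 1 / 2 := by
        rw [div_le_iff₀ hs]; linarith
      linarith
    · have h1 : ∀ j, ((inner ℝ (b j) (p - c) : ℝ) / s + 1 / 2) • s • b j =
          (inner ℝ (b j) (p - c) : ℝ) • b j + (s / 2) • b j := by
        intro j
        rw [smul_smul, ← add_smul]
        congr 1
        field_simp
      simp only [h1, Finset.sum_add_distrib]
      rw [b.sum_repr' (p - c), vadd_eq_add]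
      abel
  · rintro ⟨t, ht, h⟩ j
    have h1 : p - c = ∑ i, (t i * s - s / 2) • b i := by
      simp only [sub_smul, Finset.sum_sub_distrib]
      rw [vadd_eq_add] at h
      simp only [smul_smul] at h
      rw [← h]
      abel
    rw [h1, b.orthonormal.inner_right_fintype]
    have h2 := ht.1 j
    have h3 := ht.2 j
    simp only [Pi.zero_apply, Pi.one_apply] at h2 h3
    rw [abs_le]
    constructor <;> nlinarith

theorem isFullPolytope_cube (hs : 0 < s) : IsFullPolytope (box b c fun _ => s) := by
  constructor
  · have hfin := finite_finsetSum_sets Finset.univ (fun j => ({0, s • b j} : Set (E d)))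
      fun j => Set.toFinite _
    refine ⟨(hfin.vadd_set (a := c - ∑ j, (s / 2) • b j)).toFinset, ?_⟩
    rw [Set.Finite.coe_toFinset, convexHull_vadd, ← parallelepiped_eq_convexHull,
      box_eq_vadd_parallelepiped hs]
  · exact ⟨c, mem_interior_box fun j => by simpa using half_pos hs⟩

theorem mem_vadd_box {p y : E d} : p ∈ y +ᵥ box b c (fun _ => s) ↔
    ∀ j, |(inner ℝ (b j) p : ℝ) - inner ℝ (b j) y - inner ℝ (b j) c| ≤ s / 2 := by
  rw [Set.mem_vadd_set_iff_neg_vadd_mem]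
  refine forall_congr' fun j => ?_
  rw [vadd_eq_add, show -y + p - c = p - y - c by abel, inner_sub_right, inner_sub_right]

/-- Translates of a cube with disjoint interiors have distinct translation vectors. -/
theorem injective_of_disjoint_interior_cubes (hs : 0 < s) {x : Fin n → E d}
    (hd : ∀ i j, i ≠ j → Disjoint (interior (x i +ᵥ box b c fun _ => s))
      (interior (x j +ᵥ box b c fun _ => s))) : Function.Injective x := by
  intro i j hij
  by_contra hne
  have h := hd i j hne
  rw [hij, disjoint_self, Set.bot_eq_empty, interior_vadd] at h
  have h2 : (x j +ᵥ interior (box b c fun _ => s)).Nonempty :=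
    (isFullPolytope_cube hs).2.vadd_set
  rw [h] at h2
  exact Set.not_nonempty_empty h2

/-- Two translates of a cube along one of its axes that have disjoint interiors are at least one
edge length apart. -/
theorem le_abs_sub_of_disjoint_interior_cubes {y z : E d} {j : Fin d}
    (hyz : ∀ m, m ≠ j → (inner ℝ (b m) y : ℝ) = inner ℝ (b m) z) (hs : 0 < s)
    (hd : Disjoint (interior (y +ᵥ box b c fun _ => s)) (interior (z +ᵥ box b c fun _ => s))) :
    s ≤ |(inner ℝ (b j) y : ℝ) - inner ℝ (b j) z| := by
  by_contra! hlt
  -- Otherwise the midpoint of the two centers is interior to both cubes; `key` serves both by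
  -- symmetry.
  have key : ∀ y z : E d, (∀ m, m ≠ j → (inner ℝ (b m) y : ℝ) = inner ℝ (b m) z) →
      |(inner ℝ (b j) y : ℝ) - inner ℝ (b j) z| < s →
      (1 / 2 : ℝ) • (y + z) + c ∈ interior (y +ᵥ box b c fun _ => s) := by
    intro y z hyz hlt
    rw [interior_vadd, Set.mem_vadd_set_iff_neg_vadd_mem, vadd_eq_add]
    refine mem_interior_box fun m => ?_
    have h1 : -y + ((1 / 2 : ℝ) • (y + z) + c) - c = (1 / 2 : ℝ) • (z - y) := by module
    rw [h1, inner_smul_right, inner_sub_right, abs_mul, abs_of_pos (by norm_num : (0 : ℝ) < 1 / 2)]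
    by_cases hm : m = j
    · subst hm
      rw [abs_sub_comm]
      linarith
    · rw [hyz m hm, sub_self, abs_zero]
      linarith
  refine Set.disjoint_left.1 hd (key y z hyz hlt) ?_
  rw [add_comm y z]
  exact key z y (fun m hm => (hyz m hm).symm) (by rwa [abs_sub_comm])

/-- Starting at the end of `[-h, h]` on the side of `a`, a shift that stays inside cannot point the
way of `a`. -/
theorem mul_nonpos_of_abs_add_mul_sign_le {y a h : ℝ}
    (hy : |y + h * (SignType.sign a : ℝ)| ≤ h) : y * a ≤ 0 := by
  rcases lt_trichotomy a 0 with ha | rfl | ha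
  · rw [sign_neg ha, SignType.coe_neg_one] at hy
    exact mul_nonpos_of_nonneg_of_nonpos (by linarith [(abs_le.1 hy).1]) ha.le
  · rw [mul_zero]
  · rw [sign_pos ha, SignType.coe_one] at hy
    exact mul_nonpos_of_nonpos_of_nonneg (by linarith [(abs_le.1 hy).2]) ha.le

/-- If a union of finitely many, at least two, distinct collinear translates of a cube is convex,
then the translation direction is that of an edge of the cube. -/
theorem exists_axis_of_convex_union (hs : 0 < s) {x : Fin n → E d} {p₀ v : E d} {r : Fin n → ℝ}
    (hx : ∀ i, x i = r i • v + p₀) {i₁ i₂ : Fin n} (h12 : r i₁ ≠ r i₂)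
    (hconv : Convex ℝ (⋃ i, x i +ᵥ box b c fun _ => s)) {j m : Fin d} (hjm : j ≠ m)
    (hj : (inner ℝ (b j) v : ℝ) ≠ 0) : (inner ℝ (b m) v : ℝ) = 0 := by
  by_contra hm
  set α : ℝ := inner ℝ (b j) v with hα
  set β : ℝ := inner ℝ (b m) v with hβ
  -- If both `α` and `β` are nonzero, the line through `q` in direction `v` meets the cube only in
  -- `q`: coordinate `j` forces `ρ α β ≤ 0`, coordinate `m` forces `ρ α β ≥ 0`.
  let q : E d := c + (s / 2) • ((SignType.sign β : ℝ) • b j - (SignType.sign α : ℝ) • b m)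
  have hbjm : (inner ℝ (b j) (b m) : ℝ) = 0 := b.orthonormal.2 hjm
  have hbmj : (inner ℝ (b m) (b j) : ℝ) = 0 := b.orthonormal.2 hjm.symm
  have habs : ∀ a : ℝ, |(SignType.sign a : ℝ)| ≤ 1 := by
    intro a
    rcases SignType.sign a with _ | _ | _ <;> simp
  have hqj : (inner ℝ (b j) q : ℝ) = inner ℝ (b j) c + s / 2 * SignType.sign β := by
    simp [q, inner_add_right, inner_smul_right, inner_sub_right, hbjm]
  have hqm : (inner ℝ (b m) q : ℝ) = inner ℝ (b m) c - s / 2 * SignType.sign α := by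
    simp [q, inner_add_right, inner_smul_right, inner_sub_right, hbmj]
    ring
  have hqC : ∀ i, x i + q ∈ x i +ᵥ box b c fun _ => s := by
    intro i
    refine ⟨q, fun k => ?_, rfl⟩
    rw [inner_sub_right]
    by_cases hkj : k = j
    · subst hkj
      rw [hqj, add_sub_cancel_left, abs_mul, abs_of_pos (half_pos hs)]
      exact mul_le_of_le_one_right (half_pos hs).le (habs β)
    by_cases hkm : k = m
    · subst hkm
      rw [hqm, sub_sub_cancel_left, abs_neg, abs_mul, abs_of_pos (half_pos hs)]
      exact mul_le_of_le_one_right (half_pos hs).le (habs α)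
    · have h1 : (inner ℝ (b k) (b j) : ℝ) = 0 := b.orthonormal.2 hkj
      have h2 : (inner ℝ (b k) (b m) : ℝ) = 0 := b.orthonormal.2 hkm
      have : (inner ℝ (b k) q : ℝ) = inner ℝ (b k) c := by
        simp [q, inner_add_right, inner_smul_right, inner_sub_right, h1, h2]
      rw [this, sub_self, abs_zero]
      exact (half_pos hs).le
  have hmem : ∀ θ ∈ Set.Icc (0 : ℝ) 1, ∃ i, r i₁ + θ * (r i₂ - r i₁) = r i := by
    intro θ hθ
    have h1 := hconv (Set.mem_iUnion.2 ⟨i₁, hqC i₁⟩) (Set.mem_iUnion.2 ⟨i₂, hqC i₂⟩)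
      (sub_nonneg.2 hθ.2) hθ.1 (by ring : 1 - θ + θ = 1)
    obtain ⟨i, hi⟩ := Set.mem_iUnion.1 h1
    refine ⟨i, ?_⟩
    have h2 : (1 - θ) • (x i₁ + q) + θ • (x i₂ + q) =
        (r i₁ + θ * (r i₂ - r i₁)) • v + p₀ + q := by
      rw [hx, hx]
      module
    rw [h2, mem_vadd_box] at hi
    have hj' := hi j
    have hm' := hi m
    rw [hx] at hj' hm'
    simp only [inner_add_right, inner_smul_right, hqj, hqm] at hj' hm'
    rw [← hα] at hj'
    rw [← hβ] at hm'
    set ρ := r i₁ + θ * (r i₂ - r i₁) - r i with hρ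
    have e1 : |ρ * α + s / 2 * SignType.sign β| ≤ s / 2 := by
      convert hj' using 2
      rw [hρ]; ring
    have e2 : |ρ * β - s / 2 * SignType.sign α| ≤ s / 2 := by
      convert hm' using 2
      rw [hρ]; ring
    have f1 := mul_nonpos_of_abs_add_mul_sign_le e1
    have f2 := mul_nonpos_of_abs_add_mul_sign_le (y := -(ρ * β)) (a := α) (h := s / 2) (by
      rwa [neg_add_eq_sub, abs_sub_comm])
    have hρ0 : ρ = 0 := by
      have : ρ * (α * β) = 0 := by linarith
      exact (mul_eq_zero.1 this).resolve_right (mul_ne_zero hj hm)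
    linarith
  -- Every point of the segment from `x i₁ + q` to `x i₂ + q` is thus some `x i + q`, impossible
  -- with finitely many indices.
  have hinf : (Set.Icc (0 : ℝ) 1).Infinite := Set.Icc_infinite one_pos
  have : Nonempty (Fin n) := ⟨i₁⟩
  choose! g hg using hmem
  obtain ⟨θ, hθ, θ', hθ', hne, heq⟩ :=
    hinf.exists_ne_map_eq_of_mapsTo (f := g) (t := Set.univ) (fun _ _ => trivial) Set.finite_univ
  have h3 := hg θ hθ
  have h4 := hg θ' hθ'
  rw [heq, ← h4] at h3
  have h5 : (θ - θ') * (r i₂ - r i₁) = 0 := by linarith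
  rcases mul_eq_zero.1 h5 with h | h
  · exact hne (sub_eq_zero.1 h)
  · exact h12 (sub_eq_zero.1 h).symm

/-- No homothet of a cube smaller than `n` times the cube covers a row of `n` cubes. -/
theorem one_le_of_mem_coverFactors (hn : 2 ≤ n) (hs : 0 < s) {x : Fin n → E d}
    (hd : ∀ i j, i ≠ j → Disjoint (interior (x i +ᵥ box b c fun _ => s))
      (interior (x j +ᵥ box b c fun _ => s)))
    (hconv : Convex ℝ (⋃ i, x i +ᵥ box b c fun _ => s))
    (hcol : Collinear ℝ (Set.range fun i => x i + c)) {l : ℝ}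
    (hl : l ∈ coverFactors (box b c fun _ => s) x fun _ => 1) : 1 ≤ l := by
  obtain ⟨p₀, v, hv⟩ := (collinear_iff_exists_forall_eq_smul_vadd _).1 hcol
  choose r hr using fun i => hv _ ⟨i, rfl⟩
  have hx : ∀ i, x i = r i • v + (p₀ - c) := fun i => by
    have := hr i
    rw [vadd_eq_add] at this
    rw [eq_sub_of_add_eq this]
    abel
  have hinj := injective_of_disjoint_interior_cubes hs hd
  have h01 : x ⟨0, by omega⟩ ≠ x ⟨1, by omega⟩ := fun h => by simpa using hinj h
  have hr01 : r ⟨0, by omega⟩ ≠ r ⟨1, by omega⟩ := fun h => h01 (by rw [hx, hx, h])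
  have hv0 : v ≠ 0 := by
    rintro rfl
    exact h01 (by rw [hx, hx, smul_zero, smul_zero])
  obtain ⟨j, hj⟩ : ∃ j, (inner ℝ (b j) v : ℝ) ≠ 0 := by
    by_contra! h
    refine hv0 ?_
    rw [← b.sum_repr' v]
    simp [h]
  have hother : ∀ i i' m, m ≠ j → (inner ℝ (b m) (x i) : ℝ) = inner ℝ (b m) (x i') := by
    intro i i' m hm
    rw [hx, hx, inner_add_right, inner_add_right, inner_smul_right, inner_smul_right,
      exists_axis_of_convex_union hs hx hr01 hconv hm.symm hj, mul_zero, mul_zero]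
  have hsep : ∀ i i', i ≠ i' → s ≤ |(inner ℝ (b j) (x i) : ℝ) - inner ℝ (b j) (x i')| :=
    fun i i' h => le_abs_sub_of_disjoint_interior_cubes (hother i i') hs (hd i i' h)
  obtain ⟨hl0, t, ht⟩ := hl
  set L : ℝ := l * ∑ _i : Fin n, (1 : ℝ) with hL
  have hLn : L = l * n := by simp [hL]
  have hn0 : (0 : ℝ) < n := by exact_mod_cast (by omega : 0 < n)
  have hL0 : 0 < L := by rw [hLn]; positivity
  have hcov : ∀ i, ∀ a : ℝ, |a| ≤ s / 2 →
      |(inner ℝ (b j) (x i) : ℝ) + inner ℝ (b j) c + a - inner ℝ (b j) t - L * inner ℝ (b j) c| ≤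
        L * (s / 2) := by
    intro i a ha
    have h1 : x i + (c + a • b j) ∈ familyUnion (box b c fun _ => s) x fun _ => 1 := by
      refine Set.mem_iUnion.2 ⟨i, c + a • b j, ?_, rfl⟩
      rw [one_smul]
      intro m
      rw [add_sub_cancel_left, inner_smul_right]
      by_cases hm : m = j
      · subst hm
        simpa using ha
      · have : (inner ℝ (b m) (b j) : ℝ) = 0 := b.orthonormal.2 hm
        rw [this, mul_zero, abs_zero]
        exact (half_pos hs).le
    obtain ⟨_, ⟨y, hy, rfl⟩, h2⟩ := ht h1
    have h3 := hy j
    have h4 := congrArg (fun p => (inner ℝ (b j) p : ℝ)) h2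
    simp only [vadd_eq_add, inner_add_right, inner_smul_right, real_inner_self_eq_norm_sq,
      b.orthonormal.1 j] at h4
    have h5 : (inner ℝ (b j) (x i) : ℝ) + inner ℝ (b j) c + a - inner ℝ (b j) t -
        L * inner ℝ (b j) c = L * inner ℝ (b j) (y - c) := by
      rw [inner_sub_right]
      linarith
    rw [h5, abs_mul, abs_of_pos hL0]
    exact mul_le_mul_of_nonneg_left h3 hL0.le
  -- `A` and `B` bound the projection of the covering cube, with center `t + L c` and half-width `L
  -- s / 2`, shifted by `c` because the intervals are centered at `x i` instead of `x i + c`.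
  have hsum := sum_le_sub_of_disjoint
    (A := inner ℝ (b j) t + L * inner ℝ (b j) c - inner ℝ (b j) c - L * (s / 2))
    (B := inner ℝ (b j) t + L * inner ℝ (b j) c - inner ℝ (b j) c + L * (s / 2))
    (by nlinarith) (fun i => inner ℝ (b j) (x i) - s / 2) (fun i => inner ℝ (b j) (x i) + s / 2)
    (fun i => by linarith) (fun i i' hii' => by
      refine Set.disjoint_left.2 fun a ha ha' => ?_
      have := hsep i i' hii'
      rcases le_abs.1 this with h | h
      · linarith [ha.1, ha'.2]
      · linarith [ha.2, ha'.1])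
    (fun i a ha => by
      have := abs_le.1 (hcov i (a - inner ℝ (b j) (x i))
        (abs_le.2 ⟨by linarith [ha.1], by linarith [ha.2]⟩))
      constructor <;> linarith [this.1, this.2])
  have h6 : ∑ i : Fin n, (((inner ℝ (b j) (x i) : ℝ) + s / 2) - (inner ℝ (b j) (x i) - s / 2)) =
      n * s := by
    simp
  rw [h6, hLn] at hsum
  have h7 : 1 * (n * s) ≤ l * (n * s) := by linarith
  exact le_of_mul_le_mul_right h7 (by positivity)

end WIP

/-! ### Assembly of (a) and (b). -/

theorem mainTheorem6 (d k n : ℕ) (hk : 1 ≤ k) (hkd : k + 2 ≤ d) (hn : 2 ≤ n) :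
    (∀ (P : Set (WIP.E d)) (x : Fin n → WIP.E d) (τ : Fin n → ℝ),
      WIP.IsFullPolytope P → (∀ i, 0 < τ i) → WIP.IsWIP k P x τ →
        WIP.SlidesFreely (convexHull ℝ (WIP.familyUnion P x τ)) ((∑ i, τ i) • P) ∧
        WIP.IsSummand (convexHull ℝ (WIP.familyUnion P x τ)) ((∑ i, τ i) • P) ∧
        IsLeast (WIP.coverFactors P x τ) (WIP.Lam P x τ) ∧
        WIP.Lam P x τ ≤ 1) ∧
    (∀ (C : Set (WIP.E d)) (c : WIP.E d) (x : Fin n → WIP.E d),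
      WIP.IsCube C c →
      (∀ i j, i ≠ j → Disjoint (interior (x i +ᵥ C)) (interior (x j +ᵥ C))) →
      WIP.IsBox (⋃ i, x i +ᵥ C) →
      Collinear ℝ (Set.range fun i => x i + c) →
        WIP.IsWIP k C x (fun _ => 1) ∧ WIP.Lam C x (fun _ => 1) = 1) := by
  have hfirst : ∀ (P : Set (WIP.E d)) (x : Fin n → WIP.E d) (τ : Fin n → ℝ),
      WIP.IsFullPolytope P → (∀ i, 0 < τ i) → WIP.IsWIP k P x τ →
        WIP.SlidesFreely (convexHull ℝ (WIP.familyUnion P x τ)) ((∑ i, τ i) • P) ∧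
        WIP.IsSummand (convexHull ℝ (WIP.familyUnion P x τ)) ((∑ i, τ i) • P) ∧
        IsLeast (WIP.coverFactors P x τ) (WIP.Lam P x τ) ∧
        WIP.Lam P x τ ≤ 1 := by
    rintro P x τ ⟨⟨V, rfl⟩, hint⟩ hτ hwip
    have hV : V.Nonempty := Finset.coe_nonempty.1
      (convexHull_nonempty_iff.1 (hint.mono interior_subset))
    have hsum := hwip.isSummand hkd (by omega) hV hint hτ
    have hone := hsum.one_mem_coverFactors
    have hleast := WIP.isLeast_coverFactors (by omega) hV hint (by omega) hτ ⟨1, hone⟩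
    exact ⟨hsum.slidesFreely ((V.finite_toSet.isCompact_convexHull (𝕜 := ℝ)).smul _).isClosed,
      hsum, hleast, hleast.2 hone⟩
  refine ⟨hfirst, ?_⟩
  rintro C c x ⟨b, s, hs, rfl⟩ hdisj ⟨b', c', w, hw, hbox⟩ hcol
  have hconv : Convex ℝ (⋃ i, x i +ᵥ WIP.box b c fun _ => s) := hbox ▸ WIP.convex_box w
  have hfam : WIP.familyUnion (WIP.box b c fun _ => s) x (fun _ => 1) =
      ⋃ i, x i +ᵥ WIP.box b c fun _ => s := by
    simp [WIP.familyUnion, WIP.homothet]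
  have hwip : WIP.IsWIP k (WIP.box b c fun _ => s) x fun _ => 1 := by
    rintro L - - ⟨p, hpL, hp⟩
    -- A box is its own convex hull, so a point of the flat in the hull already lies in a member.
    rw [hfam, hconv.convexHull_eq, ← hfam] at hp
    obtain ⟨i, hi⟩ := Set.mem_iUnion.1 hp
    exact ⟨i, p, hpL, hi⟩
  obtain ⟨-, -, hleast, hle⟩ := hfirst _ x (fun _ => 1) (WIP.isFullPolytope_cube hs)
    (fun _ => one_pos) hwip
  exact ⟨hwip, hle.antisymm
    (WIP.one_le_of_mem_coverFactors hn hs hdisj hconv hcol hleast.1)⟩
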